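/- Let $n\ge 2$ and let $\mathcal K^n$ be the space of convex bodies (non-empty, compact, convex sets) in Euclidean space $\mathbb R^n$ with the Hausdorff metric. Let $\mathcal K^n_c\subset\mathcal K^n$ be the set of bodies that have a centre of symmetry (symmetric bodies), and let $\mathcal K^n_o\subset\mathcal K^n_c$ be the set of bodies with centre of symmetry $0$. A Minkowski class is a subset of $\mathcal K^n$ that is closed in the Hausdorff metric and closed under Minkowski addition and under dilatations $L\mapsto\lambda L$, $\lambda\ge 0$. It is rotation invariant if it contains $\vartheta L$ whenever it contains $L$, for every $\vartheta\in SO(n)$. For a Minkowski class $\mathcal M$, a convex body $L\in\mathcal K^n$ is a generalized $\mathcal M$-body if there are $T_1,T_2\in\mathcal M$ with $L+T_1=T_2$. For $m\in\mathbb N_0$ let $\mathcal H^n_m\subset C(S^{n-1})$ be the space of spherical harmonics of order $m$, that is, of restrictions to the unit sphere $S^{n-1}$ of harmonic homogeneous polynomials of degree $m$ on $\mathbb R^n$ (and $0$), and let $\pi_m:C(S^{n-1})\to\mathcal H^n_m$ be the orthogonal projection with respect to $(f,g)=\int_{S^{n-1}}fg\,d\sigma$, where $\sigma$ is the spherical Lebesgue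 measure. For $K\in\mathcal K^n$ let $h_K(u)=\max\{\langle u,y\rangle:y\in K\}$, $u\in S^{n-1}$. The body $K$ is universal if $\pi_m h_K\neq 0$ for all $m\in\mathbb N_0$, and centrally universal if $\pi_m h_K\ne 0$ for all even $m\in\mathbb N_0$. Let $K\in\mathcal K^n$, and let $\mathcal M$ be the rotation invariant Minkowski class generated by $K$, that is, the smallest rotation invariant Minkowski class containing $K$. (a) The set of generalized $\mathcal M$-bodies is dense in $\mathcal K^n$ if and only if $K$ is universal. (b) Let $K$ be symmetric. If the centre of $K$ is different from $0$, then the set of generalized $\mathcal M$-bodies is a dense subset of $\mathcal K^n_c$ if and only if $K$ is centrally universal. If the centre of $K$ is $0$, then the set of generalized $\mathcal M$-bodies is a dense subset of $\mathcal K^n_o$ if and only if $K$ is centrally universal. -/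

import Mathlib

noncomputable section

namespace RotMinkowski

/-! ### Support functions -/

/-- The support function `h(K, x) = max {⟨x, y⟩ : y ∈ K}` of a convex body in `ℝⁿ`. -/
def supportFun {n : ℕ} (K : ConvexBody (EuclideanSpace ℝ (Fin n)))
    (x : EuclideanSpace ℝ (Fin n)) : ℝ :=
  sSup ((fun y => inner ℝ x y) '' (K : Set (EuclideanSpace ℝ (Fin n))))

theorem continuous_supportFun {n : ℕ} (K : ConvexBody (EuclideanSpace ℝ (Fin n))) :
    Continuous (supportFun K) :=
  IsCompact.continuous_sSup (f := fun x y : EuclideanSpace ℝ (Fin n) => inner ℝ x y)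
    K.isCompact (by fun_prop)

/-- `h_K`, the restriction of the support function of `K` to the unit sphere, as an element of
`C(Sⁿ⁻¹)`. -/
def sphereSupport {n : ℕ} (K : ConvexBody (EuclideanSpace ℝ (Fin n))) :
    C(Metric.sphere (0 : EuclideanSpace ℝ (Fin n)) 1, ℝ) where
  toFun u := supportFun K u
  continuous_toFun := (continuous_supportFun K).comp continuous_subtype_val

/-! ### Spherical harmonics -/

/-- The Laplace operator `∑ᵢ ∂²/∂xᵢ²` on polynomials in `n` variables. -/
def polyLaplacian (n : ℕ) : MvPolynomial (Fin n) ℝ →ₗ[ℝ] MvPolynomial (Fin n) ℝ :=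
  ∑ i : Fin n, (MvPolynomial.pderiv i).toLinearMap ∘ₗ (MvPolynomial.pderiv i).toLinearMap

/-- The harmonic polynomials on `ℝⁿ` that are homogeneous of degree `m` (and zero). -/
def harmonicPoly (n m : ℕ) : Submodule ℝ (MvPolynomial (Fin n) ℝ) :=
  MvPolynomial.homogeneousSubmodule (Fin n) ℝ m ⊓ LinearMap.ker (polyLaplacian n)

/-- Restriction of a polynomial on `ℝⁿ` to the unit sphere. -/
def restrictSphere (n : ℕ) : MvPolynomial (Fin n) ℝ →ₗ[ℝ]
    C(Metric.sphere (0 : EuclideanSpace ℝ (Fin n)) 1, ℝ) where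
  toFun p :=
    { toFun := fun u => MvPolynomial.eval (fun i => (u : EuclideanSpace ℝ (Fin n)) i) p
      continuous_toFun := by
        refine (MvPolynomial.continuous_eval p).comp ?_
        fun_prop }
  map_add' p q := by ext u; simp
  map_smul' c p := by ext u; simp [MvPolynomial.smul_eval]

/-- The space `ℋⁿₘ ⊆ C(Sⁿ⁻¹)` of spherical harmonics of dimension `n` and order `m`. -/
def sphericalHarmonic (n m : ℕ) :
    Submodule ℝ C(Metric.sphere (0 : EuclideanSpace ℝ (Fin n)) 1, ℝ) :=
  (harmonicPoly n m).map (restrictSphere n)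

instance finiteDimensional_sphericalHarmonic (n m : ℕ) :
    FiniteDimensional ℝ (sphericalHarmonic n m) := by
  have h : FiniteDimensional ℝ (MvPolynomial.homogeneousSubmodule (Fin n) ℝ m) :=
    Module.Finite.iff_fg.mpr (MvPolynomial.homogeneousSubmodule_fg (Fin n) ℝ m)
  have h2 : FiniteDimensional ℝ (harmonicPoly n m) :=
    Submodule.finiteDimensional_of_le inf_le_left
  unfold sphericalHarmonic
  infer_instance

/-- The spherical Lebesgue measure `σ` on the unit sphere of `ℝⁿ`. -/
abbrev sphereMeasure (n : ℕ) :
    MeasureTheory.Measure (Metric.sphere (0 : EuclideanSpace ℝ (Fin n)) 1) :=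
  (MeasureTheory.volume : MeasureTheory.Measure (EuclideanSpace ℝ (Fin n))).toSphere

/-- The embedding of `C(Sⁿ⁻¹)`, with the scalar product `(f, g) = ∫ f g dσ`, into the Hilbert
space `L²(σ)`. -/
def toL2 (n : ℕ) : C(Metric.sphere (0 : EuclideanSpace ℝ (Fin n)) 1, ℝ) →ₗ[ℝ]
    MeasureTheory.Lp ℝ 2 (sphereMeasure n) :=
  (ContinuousMap.toLp (E := ℝ) 2 (sphereMeasure n) ℝ).toLinearMap

theorem toL2_injective (n : ℕ) : Function.Injective (toL2 n) :=
  ContinuousMap.toLp_injective (sphereMeasure n)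

/-- The orthogonal projection `πₘ : C(Sⁿ⁻¹) → ℋⁿₘ` with respect to `(f, g) = ∫ f g dσ`: the
orthogonal projection of `L²(σ)` onto the (finite-dimensional) image of `ℋⁿₘ`, read back in
`ℋⁿₘ`. -/
def harmonicProj (n m : ℕ) : C(Metric.sphere (0 : EuclideanSpace ℝ (Fin n)) 1, ℝ) →ₗ[ℝ]
    sphericalHarmonic n m :=
  (Submodule.equivMapOfInjective (toL2 n) (toL2_injective n)
      (sphericalHarmonic n m)).symm.toLinearMap ∘ₗ
    (((sphericalHarmonic n m).map (toL2 n)).orthogonalProjectionOnto).toLinearMap ∘ₗ toL2 n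

/-- `K` is universal: `πₘ h_K ≠ 0` for all `m`. -/
def IsUniversal {n : ℕ} (K : ConvexBody (EuclideanSpace ℝ (Fin n))) : Prop :=
  ∀ m : ℕ, harmonicProj n m (sphereSupport K) ≠ 0

/-- `K` is centrally universal: `πₘ h_K ≠ 0` for all even `m`. -/
def IsCentrallyUniversal {n : ℕ} (K : ConvexBody (EuclideanSpace ℝ (Fin n))) : Prop :=
  ∀ m : ℕ, Even m → harmonicProj n m (sphereSupport K) ≠ 0

/-! ### Minkowski classes -/

/-- The image `gK` of a convex body under a rotation `g ∈ SO(n)`. -/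
def rotate {n : ℕ} (g : Matrix.specialOrthogonalGroup (Fin n) ℝ)
    (K : ConvexBody (EuclideanSpace ℝ (Fin n))) : ConvexBody (EuclideanSpace ℝ (Fin n)) where
  carrier := Matrix.toEuclideanCLM (n := Fin n) (𝕜 := ℝ) (g : Matrix (Fin n) (Fin n) ℝ) ''
    (K : Set (EuclideanSpace ℝ (Fin n)))
  convex' := K.convex.linear_image
    (Matrix.toEuclideanCLM (n := Fin n) (𝕜 := ℝ) (g : Matrix (Fin n) (Fin n) ℝ)).toLinearMap
  isCompact' := K.isCompact.image (ContinuousLinearMap.continuous _)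
  nonempty' := K.nonempty.image _

/-- A Minkowski class: a set of convex bodies that is closed in the Hausdorff metric and closed
under Minkowski addition and dilatation. -/
structure IsMinkowskiClass {n : ℕ} (M : Set (ConvexBody (EuclideanSpace ℝ (Fin n)))) :
    Prop where
  isClosed : IsClosed M
  add_mem : ∀ K ∈ M, ∀ L ∈ M, K + L ∈ M
  smul_mem : ∀ c : ℝ, 0 ≤ c → ∀ K ∈ M, c • K ∈ M

/-- Rotation invariance of a set of convex bodies. -/
def IsRotationInvariant {n : ℕ} (M : Set (ConvexBody (EuclideanSpace ℝ (Fin n)))) : Prop :=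
  ∀ g : Matrix.specialOrthogonalGroup (Fin n) ℝ, ∀ K ∈ M, rotate g K ∈ M

/-- The rotation invariant Minkowski class generated by `K`, i.e. the smallest rotation invariant
Minkowski class that contains `K`. -/
def generatedClass {n : ℕ} (K : ConvexBody (EuclideanSpace ℝ (Fin n))) :
    Set (ConvexBody (EuclideanSpace ℝ (Fin n))) :=
  ⋂₀ {M | IsMinkowskiClass M ∧ IsRotationInvariant M ∧ K ∈ M}

/-- The generalized `M`-bodies: convex bodies `L` with `L + T₁ = T₂` for some `T₁, T₂ ∈ M`. -/
def generalizedBodies {n : ℕ} (M : Set (ConvexBody (EuclideanSpace ℝ (Fin n)))) :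
    Set (ConvexBody (EuclideanSpace ℝ (Fin n))) :=
  {L | ∃ T₁ ∈ M, ∃ T₂ ∈ M, L + T₁ = T₂}

/-! ### Symmetric bodies -/

/-- `c` is a centre of symmetry of `K`. -/
def HasCentre {n : ℕ} (K : ConvexBody (EuclideanSpace ℝ (Fin n)))
    (c : EuclideanSpace ℝ (Fin n)) : Prop :=
  Equiv.pointReflection c '' (K : Set (EuclideanSpace ℝ (Fin n))) = K

/-- The set of convex bodies in `ℝⁿ` that have a centre of symmetry. -/
def symmetricBodies (n : ℕ) : Set (ConvexBody (EuclideanSpace ℝ (Fin n))) :=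
  {K | ∃ c, HasCentre K c}

/-- The set of convex bodies in `ℝⁿ` with centre of symmetry `0`. -/
def originSymmetricBodies (n : ℕ) : Set (ConvexBody (EuclideanSpace ℝ (Fin n))) :=
  {K | HasCentre K 0}

/-- `A` is a dense subset of the subspace `X` of a topological space. -/
def IsDenseSubset {α : Type*} [TopologicalSpace α] (A X : Set α) : Prop :=
  A ⊆ X ∧ X ⊆ closure A

end RotMinkowski

end

noncomputable section

namespace RotMinkowski

open MeasureTheory Set Filter Topology
open scoped Pointwise

/-! The map K ↦ h_K is an additive, rotation equivariant isometry of the convex bodies onto a closed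
convex cone in C(Sⁿ⁻¹), the functions with sublinear extension. Under it the generalized M-bodies
become the support functions lying in the linear space D = h(M) - h(M)
(`mem_generalizedBodies_iff`), and everything is decided by which spherical harmonics D contains.

Necessity. The condition πₘ h = 0 is linear, closed and rotation invariant. If K satisfies it, so
does every body in the closure of the generalized bodies (`sphereSupport_mem_of_mem_closure`). But
differences of support functions are dense in C(Sⁿ⁻¹), so some body L violates it. For even m the
body L + (-L) does so too, and it has centre 0.

Sufficiency. Let h = h_K and let q be a harmonic of order m with (h, q) ≠ 0. The kernel Φ(u, x) = ∫
h(g⁻¹u) q(g⁻¹x) dg over SO(n) lies in D as a function of u, since a closed convex cone is stable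
under integration, and in ℋₘ as a function of x. Its rotation invariance allows the arguments to be
swapped up to an improper isometry, so it lies in ℋₘ in u as well. It is not zero, because its
diagonal has integral a positive multiple of (h, q). As ℋₘ is irreducible, ℋₘ ⊆ D
(`sphericalHarmonic_le_differenceSpace`).

If this holds for all m, then D contains all polynomials on the sphere. Integrating h_L against the
kernel (1 + ⟨u, v⟩)ᵏ gives a polynomial that is again sublinear (`smoothing_sphereSupport_mem`) and,
once normalized, tends uniformly to h_L. So L is a limit of bodies with support function in D. If
h_L is even, only even harmonics occur. Other centres need linear functionals in D, which a nonzero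
centre of K supplies through its component of order one. -/

/-- Euclidean space of dimension `n`. -/
abbrev Euc (n : ℕ) := EuclideanSpace ℝ (Fin n)

/-- The unit sphere of `Euc n`. -/
abbrev Sph (n : ℕ) := Metric.sphere (0 : Euc n) 1

variable {n : ℕ}

/-! ### Support functions and the Hausdorff metric. -/

section Support

variable (K L : ConvexBody (Euc n))

theorem inner_le_supportFun (x : Euc n) {y : Euc n} (hy : y ∈ K) :
    inner ℝ x y ≤ supportFun K x := by
  refine le_csSup ?_ ⟨y, hy, rfl⟩
  exact (K.isCompact.image (by fun_prop)).bddAbove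

theorem exists_supportFun_eq (x : Euc n) : ∃ y ∈ K, supportFun K x = inner ℝ x y := by
  obtain ⟨y, hy, h⟩ := K.isCompact.exists_sSup_image_eq K.nonempty
    (f := fun y => inner ℝ x y) (by fun_prop)
  exact ⟨y, hy, h⟩

variable {K L} in
theorem supportFun_le {x : Euc n} {c : ℝ} (h : ∀ y ∈ K, inner ℝ x y ≤ c) :
    supportFun K x ≤ c := by
  obtain ⟨y, hy, e⟩ := exists_supportFun_eq K x
  exact e ▸ h y hy

variable {K L} in
theorem supportFun_eq {x : Euc n} {y : Euc n} (hy : y ∈ K)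
    (h : ∀ z ∈ K, inner ℝ x z ≤ inner ℝ x y) : supportFun K x = inner ℝ x y :=
  le_antisymm (supportFun_le h) (inner_le_supportFun K x hy)

theorem supportFun_smul {c : ℝ} (hc : 0 ≤ c) (x : Euc n) :
    supportFun K (c • x) = c * supportFun K x := by
  obtain ⟨y, hy, e⟩ := exists_supportFun_eq K x
  rw [e, supportFun_eq hy, real_inner_smul_left]
  intro z hz
  rw [real_inner_smul_left, real_inner_smul_left, ← e]
  exact mul_le_mul_of_nonneg_left (inner_le_supportFun K x hz) hc

theorem supportFun_add_le (x y : Euc n) :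
    supportFun K (x + y) ≤ supportFun K x + supportFun K y := by
  refine supportFun_le fun z hz => ?_
  rw [inner_add_left]
  exact add_le_add (inner_le_supportFun K x hz) (inner_le_supportFun K y hz)

theorem supportFun_body_add (x : Euc n) :
    supportFun (K + L) x = supportFun K x + supportFun L x := by
  obtain ⟨y, hy, e⟩ := exists_supportFun_eq K x
  obtain ⟨z, hz, e'⟩ := exists_supportFun_eq L x
  have hm : y + z ∈ K + L := Set.add_mem_add hy hz
  rw [e, e', ← inner_add_right]
  refine supportFun_eq hm ?_
  rintro w ⟨a, ha, b, hb, rfl⟩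
  simp only [inner_add_right]
  rw [← e, ← e']
  exact add_le_add (inner_le_supportFun K x ha) (inner_le_supportFun L x hb)

theorem supportFun_body_smul {c : ℝ} (hc : 0 ≤ c) (x : Euc n) :
    supportFun (c • K) x = c * supportFun K x := by
  obtain ⟨y, hy, e⟩ := exists_supportFun_eq K x
  have hm : c • y ∈ c • K := Set.smul_mem_smul_set hy
  rw [e, supportFun_eq hm, real_inner_smul_right]
  rintro _ ⟨z, hz, rfl⟩
  simp only [real_inner_smul_right]
  rw [← e]
  exact mul_le_mul_of_nonneg_left (inner_le_supportFun K x hz) hc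

theorem supportFun_body_neg (x : Euc n) :
    supportFun ((-1 : ℝ) • K) x = supportFun K (-x) := by
  obtain ⟨y, hy, e⟩ := exists_supportFun_eq K (-x)
  have hm : (-1 : ℝ) • y ∈ (-1 : ℝ) • K := Set.smul_mem_smul_set hy
  rw [e, supportFun_eq hm]
  · simp
  rintro _ ⟨z, hz, rfl⟩
  have := inner_le_supportFun K (-x) hz
  rw [e] at this
  simpa using this

theorem norm_sph (u : Sph n) : ‖(u : Euc n)‖ = 1 := by simp

@[simp]
theorem sphereSupport_apply (u : Sph n) : sphereSupport K u = supportFun K u := rfl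

theorem sphereSupport_add : sphereSupport (K + L) = sphereSupport K + sphereSupport L := by
  ext u; exact supportFun_body_add K L u

theorem sphereSupport_smul {c : ℝ} (hc : 0 ≤ c) :
    sphereSupport (c • K) = c • sphereSupport K := by
  ext u; exact supportFun_body_smul K hc u

variable {K L} in
theorem supportFun_le_add_of_hausdorffDist_lt {r : ℝ} (h : dist K L < r) (u : Sph n) :
    supportFun K u ≤ supportFun L u + r := by
  refine supportFun_le fun y hy => ?_
  obtain ⟨z, hz, hd⟩ := Metric.exists_dist_lt_of_hausdorffDist_lt hy h
    ConvexBody.hausdorffEDist_ne_top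
  have h1 := inner_le_supportFun L (u : Euc n) hz
  have h2 : inner ℝ (u : Euc n) (y - z) ≤ ‖(u : Euc n)‖ * ‖y - z‖ := real_inner_le_norm _ _
  rw [norm_sph, one_mul, ← dist_eq_norm, inner_sub_right] at h2
  linarith

variable {K L} in
-- If y is the point of L nearest to x, then the unit vector u along x - y is an outer normal of L
-- at y. Hence ‖x - y‖ = ⟨u, x⟩ - ⟨u, y⟩ ≤ h_K(u) - h_L(u).
theorem exists_dist_le_of_supportFun_le_add {r : ℝ} (hr : 0 ≤ r)
    (h : ∀ u : Sph n, supportFun K u ≤ supportFun L u + r) {x : Euc n} (hx : x ∈ K) :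
    ∃ y ∈ L, dist x y ≤ r := by
  obtain ⟨y, hy, hmin⟩ := exists_norm_eq_iInf_of_complete_convex L.nonempty
    L.isCompact.isComplete L.convex x
  have hin := (norm_eq_iInf_iff_real_inner_le_zero L.convex hy).1 hmin
  refine ⟨y, hy, ?_⟩
  by_cases hxy : x = y
  · simpa [hxy] using hr
  have hpos : 0 < ‖x - y‖ := norm_pos_iff.2 (sub_ne_zero.2 hxy)
  let u : Sph n := ⟨‖x - y‖⁻¹ • (x - y), by
    simp [norm_smul, hpos.ne']⟩
  have hu : (u : Euc n) = ‖x - y‖⁻¹ • (x - y) := rfl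
  have h1 : supportFun L u ≤ inner ℝ (u : Euc n) y := by
    refine supportFun_le fun z hz => ?_
    have := hin z hz
    rw [hu, real_inner_smul_left, real_inner_smul_left]
    refine mul_le_mul_of_nonneg_left ?_ (by positivity)
    rw [inner_sub_right] at this
    linarith
  have h2 := inner_le_supportFun K (u : Euc n) hx
  have h3 := h u
  have h4 : inner ℝ (u : Euc n) x - inner ℝ (u : Euc n) y = ‖x - y‖ := by
    rw [← inner_sub_right, hu, real_inner_smul_left, real_inner_self_eq_norm_sq]
    field_simp
  rw [dist_eq_norm]
  linarith

theorem dist_sphereSupport : dist (sphereSupport K) (sphereSupport L) = dist K L := by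
  apply le_antisymm
  · refine le_of_forall_gt_imp_ge_of_dense fun r hr => ?_
    have hr0 : 0 ≤ r := dist_nonneg.trans hr.le
    rw [ContinuousMap.dist_le hr0]
    intro u
    have h1 := supportFun_le_add_of_hausdorffDist_lt hr u
    have h2 := supportFun_le_add_of_hausdorffDist_lt (by rwa [dist_comm] at hr) u
    rw [Real.dist_eq, abs_le]
    simp only [sphereSupport_apply]
    constructor <;> linarith
  · have h : ∀ u : Sph n, |supportFun K u - supportFun L u| ≤
        dist (sphereSupport K) (sphereSupport L) := fun u =>
      ContinuousMap.dist_apply_le_dist (f := sphereSupport K) (g := sphereSupport L) u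
    refine Metric.hausdorffDist_le_of_mem_dist dist_nonneg (fun x hx => ?_) (fun x hx => ?_)
    · refine exists_dist_le_of_supportFun_le_add dist_nonneg (fun u => ?_) hx
      linarith [(abs_le.1 (h u)).2]
    · refine exists_dist_le_of_supportFun_le_add dist_nonneg (fun u => ?_) hx
      linarith [(abs_le.1 (h u)).1]

theorem isometry_sphereSupport : Isometry (sphereSupport (n := n)) :=
  Isometry.of_dist_eq dist_sphereSupport

theorem sphereSupport_injective : Function.Injective (sphereSupport (n := n)) :=
  isometry_sphereSupport.injective

end Support

/-! ### Functions on the sphere with a sublinear homogeneous extension -/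

/-- The functions on the sphere whose positively homogeneous extension is subadditive. -/
def sublinearFunctions (n : ℕ) : Set C(Sph n, ℝ) :=
  {f | ∀ (u v w : Sph n) (a b c : ℝ), 0 ≤ a → 0 ≤ b → 0 ≤ c →
    c • (w : Euc n) = a • (u : Euc n) + b • (v : Euc n) → c * f w ≤ a * f u + b * f v}

theorem isClosed_sublinearFunctions : IsClosed (sublinearFunctions n) := by
  simp only [sublinearFunctions, ofPred_forall]
  refine isClosed_iInter fun u => isClosed_iInter fun v => isClosed_iInter fun w =>
    isClosed_iInter fun a => isClosed_iInter fun b => isClosed_iInter fun c =>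
    isClosed_iInter fun _ => isClosed_iInter fun _ => isClosed_iInter fun _ =>
    isClosed_iInter fun _ => isClosed_le ?_ ?_ <;>
  fun_prop

theorem sphereSupport_mem_sublinearFunctions (K : ConvexBody (Euc n)) :
    sphereSupport K ∈ sublinearFunctions n := by
  intro u v w a b c ha hb hc h
  simp only [sphereSupport_apply]
  rw [← supportFun_smul K hc, ← supportFun_smul K ha, ← supportFun_smul K hb, h]
  exact supportFun_add_le K _ _

/-- The radial projection to the sphere, with a default value at the origin. -/
def toSph (u₀ : Sph n) (x : Euc n) : Sph n :=
  if h : x = 0 then u₀ else ⟨‖x‖⁻¹ • x, by simp [norm_smul, h]⟩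

theorem norm_smul_toSph (u₀ : Sph n) (x : Euc n) : ‖x‖ • (toSph u₀ x : Euc n) = x := by
  unfold toSph
  split_ifs with h
  · simp [h]
  · simp [smul_smul, h]

theorem toSph_coe (u₀ u : Sph n) : toSph u₀ (u : Euc n) = u := by
  ext1
  have := norm_smul_toSph u₀ (u : Euc n)
  rwa [norm_sph, one_smul] at this

theorem toSph_smul (u₀ : Sph n) {c : ℝ} (hc : 0 < c) (x : Euc n) (hx : x ≠ 0) :
    toSph u₀ (c • x) = toSph u₀ x := by
  unfold toSph
  have : c • x ≠ 0 := smul_ne_zero hc.ne' hx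
  rw [dif_neg this, dif_neg hx]
  ext1
  simp only [norm_smul, Real.norm_eq_abs, abs_of_pos hc, smul_smul]
  congr 1
  have : ‖x‖ ≠ 0 := norm_ne_zero_iff.2 hx
  field_simp

/-- A function on the sphere with sublinear extension is a support function. -/
theorem exists_sphereSupport_eq [Nonempty (Sph n)] {f : C(Sph n, ℝ)}
    (hf : f ∈ sublinearFunctions n) : ∃ K : ConvexBody (Euc n), sphereSupport K = f := by
  obtain ⟨u₀⟩ := ‹Nonempty (Sph n)›
  -- The positively homogeneous extension of f. The default direction at the origin is harmless
  -- because of the factor ‖x‖ = 0.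
  let N : Euc n → ℝ := fun x => ‖x‖ * f (toSph u₀ x)
  have N_hom : ∀ c : ℝ, 0 < c → ∀ x, N (c • x) = c * N x := by
    intro c hc x
    by_cases hx : x = 0
    · simp [N, hx]
    · simp only [N]
      rw [toSph_smul u₀ hc x hx, norm_smul, Real.norm_of_nonneg hc.le, mul_assoc]
  have N_add : ∀ x y, N (x + y) ≤ N x + N y := by
    intro x y
    refine hf _ _ _ _ _ _ (norm_nonneg _) (norm_nonneg _) (norm_nonneg _) ?_
    simp only [norm_smul_toSph]
  have N_coe : ∀ u : Sph n, N u = f u := by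
    intro u
    simp [N, toSph_coe]
  -- Hahn–Banach: the functional t • u ↦ t * f u on a line is dominated by N, and its extension is a
  -- point of the body to be built that attains the value f u in direction u.
  have key : ∀ u : Sph n, ∃ y : Euc n, (∀ x, inner ℝ x y ≤ N x) ∧ inner ℝ (u : Euc n) y = f u := by
    intro u
    have hu : (u : Euc n) ≠ 0 := by
      intro h; have := norm_sph u; simp [h] at this
    let φ : Euc n →ₗ.[ℝ] ℝ := LinearPMap.mkSpanSingleton (u : Euc n) (f u) hu
    have hφ : ∀ t : ℝ, ∀ h : t • (u : Euc n) ∈ φ.domain, φ ⟨t • (u : Euc n), h⟩ = t * f u :=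
      fun t h => LinearPMap.mkSpanSingleton'_apply _ _ _ _ _
    obtain ⟨g, hg, hgN⟩ := exists_extension_of_le_sublinear φ N N_hom N_add (by
      rintro ⟨x, hx⟩
      obtain ⟨t, rfl⟩ := Submodule.mem_span_singleton.1 hx
      rw [hφ]
      simp only
      rcases lt_trichotomy t 0 with ht | rfl | ht
      -- For negative t, subadditivity at t • u and -t • u bounds N (t • u) from below.
      · have h0 : N 0 = 0 := by simp [N]
        have h1 := N_add (t • (u : Euc n)) ((-t) • (u : Euc n))
        rw [N_hom (-t) (by linarith), N_coe] at h1
        rw [← add_smul, add_neg_cancel, zero_smul, h0] at h1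
        linarith
      · simp [N]
      · rw [N_hom t ht, N_coe])
    refine ⟨(InnerProductSpace.toDual ℝ (Euc n)).symm (LinearMap.toContinuousLinearMap g), ?_, ?_⟩
    · intro x
      rw [real_inner_comm, InnerProductSpace.toDual_symm_apply]
      exact hgN x
    · rw [real_inner_comm, InnerProductSpace.toDual_symm_apply]
      have hm : (1 : ℝ) • (u : Euc n) ∈ φ.domain :=
        Submodule.smul_mem _ _ (Submodule.mem_span_singleton_self _)
      have := hg ⟨_, hm⟩
      rw [hφ] at this
      simpa using this
  have hcl : IsClosed {y : Euc n | ∀ x, inner ℝ x y ≤ N x} := by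
    rw [ofPred_forall]
    exact isClosed_iInter fun x => isClosed_le (by fun_prop) continuous_const
  have hbd : Bornology.IsBounded {y : Euc n | ∀ x, inner ℝ x y ≤ N x} := by
    refine (Metric.isBounded_closedBall (x := (0 : Euc n)) (r := ‖f‖)).subset fun y hy => ?_
    rw [mem_closedBall_zero_iff]
    have h1 := hy y
    rw [real_inner_self_eq_norm_sq] at h1
    have h2 : f (toSph u₀ y) ≤ ‖f‖ := (le_abs_self _).trans (f.norm_coe_le_norm _)
    rcases (norm_nonneg y).eq_or_lt with h0 | h0
    · rw [← h0]; positivity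
    · simp only [N, pow_two] at h1
      exact (le_of_mul_le_mul_left h1 h0).trans h2
  let K : ConvexBody (Euc n) :=
    { carrier := {y : Euc n | ∀ x, inner ℝ x y ≤ N x}
      convex' := by
        intro y hy z hz a b ha hb hab x
        rw [inner_add_right, real_inner_smul_right, real_inner_smul_right]
        calc a * inner ℝ x y + b * inner ℝ x z ≤ a * N x + b * N x := by
              gcongr
              exacts [hy x, hz x]
          _ = N x := by rw [← add_mul, hab, one_mul]
      isCompact' := Metric.isCompact_of_isClosed_isBounded hcl hbd
      nonempty' := (key u₀).imp fun y hy => hy.1 }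
  refine ⟨K, ?_⟩
  ext u
  obtain ⟨y, hy, hyu⟩ := key u
  have hyK : y ∈ K := hy
  rw [sphereSupport_apply, supportFun_eq hyK, hyu]
  intro z hz
  rw [hyu, ← N_coe]
  exact (show ∀ x, inner ℝ x z ≤ N x from hz) u

theorem range_sphereSupport [Nonempty (Sph n)] :
    range (sphereSupport (n := n)) = sublinearFunctions n :=
  Subset.antisymm (range_subset_iff.2 sphereSupport_mem_sublinearFunctions)
    fun _ hf => exists_sphereSupport_eq hf

/-- Closed sets of bodies thus become closed sets in a Banach space, where vector-valued integrals
are available. -/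
theorem isClosedEmbedding_sphereSupport [Nonempty (Sph n)] :
    IsClosedEmbedding (sphereSupport (n := n)) :=
  ⟨isometry_sphereSupport.isEmbedding, (range_sphereSupport (n := n)).symm ▸ isClosed_sublinearFunctions⟩

/-! ### Linear isometries acting on the sphere -/

/-- The action of a linear isometry on the unit sphere. -/
def sphMap (e : Euc n ≃ₗᵢ[ℝ] Euc n) : C(Sph n, Sph n) where
  toFun u := ⟨e u, by simp⟩
  continuous_toFun := by fun_prop

@[simp]
theorem coe_sphMap (e : Euc n ≃ₗᵢ[ℝ] Euc n) (u : Sph n) : (sphMap e u : Euc n) = e u := rfl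

/-- Composition of a function on the sphere with a linear isometry. -/
def pull (e : Euc n ≃ₗᵢ[ℝ] Euc n) : C(Sph n, ℝ) →L[ℝ] C(Sph n, ℝ) :=
  { toFun := fun f => f.comp (sphMap e)
    map_add' := fun _ _ => rfl
    map_smul' := fun _ _ => rfl
    cont := ContinuousMap.continuous_precomp (sphMap e) }

@[simp]
theorem pull_apply (e : Euc n ≃ₗᵢ[ℝ] Euc n) (f : C(Sph n, ℝ)) (u : Sph n) :
    pull e f u = f (sphMap e u) := rfl

theorem pull_mul (e : Euc n ≃ₗᵢ[ℝ] Euc n) (f g : C(Sph n, ℝ)) :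
    pull e (f * g) = pull e f * pull e g := rfl

theorem sphMap_trans (e e' : Euc n ≃ₗᵢ[ℝ] Euc n) (u : Sph n) :
    sphMap (e.trans e') u = sphMap e' (sphMap e u) := rfl

theorem sphMap_symm_apply (e : Euc n ≃ₗᵢ[ℝ] Euc n) (u : Sph n) :
    sphMap e.symm (sphMap e u) = u := by ext1; simp

theorem sphMap_apply_symm (e : Euc n ≃ₗᵢ[ℝ] Euc n) (u : Sph n) :
    sphMap e (sphMap e.symm u) = u := by ext1; simp

theorem pull_pull_symm (e : Euc n ≃ₗᵢ[ℝ] Euc n) (f : C(Sph n, ℝ)) :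
    pull e (pull e.symm f) = f := by
  ext u; simp [sphMap_symm_apply]

/-- The spherical measure of s is a multiple of the volume of the cone (0, 1) · s, and linear
isometries map such cones to cones and preserve volume. -/
theorem measurePreserving_sphMap (e : Euc n ≃ₗᵢ[ℝ] Euc n) :
    MeasurePreserving (sphMap e) (sphereMeasure n) (sphereMeasure n) := by
  refine ⟨(sphMap e).continuous.measurable, ?_⟩
  ext s hs
  have hs' : MeasurableSet (sphMap e ⁻¹' s) := (sphMap e).continuous.measurable hs
  rw [Measure.map_apply (sphMap e).continuous.measurable hs, Measure.toSphere_apply' _ hs',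
    Measure.toSphere_apply' _ hs]
  congr 1
  have : Ioo (0 : ℝ) 1 • ((↑) '' (sphMap e ⁻¹' s) : Set (Euc n)) =
      e ⁻¹' (Ioo (0 : ℝ) 1 • ((↑) '' s)) := by
    ext x
    simp only [Set.mem_smul, Set.mem_image, Set.mem_preimage]
    constructor
    · rintro ⟨r, hr, _, ⟨u, hu, rfl⟩, rfl⟩
      exact ⟨r, hr, _, ⟨_, hu, rfl⟩, by simp⟩
    · rintro ⟨r, hr, _, ⟨u, hu, rfl⟩, h⟩
      refine ⟨r, hr, _, ⟨sphMap e.symm u, by rwa [sphMap_apply_symm], rfl⟩, ?_⟩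
      apply e.injective
      simp [h]
  rw [this]
  exact (e.measurePreserving).measure_preimage_equiv (f := e.toMeasurableEquiv) _

/-! ### The integral over the sphere -/

theorem integrable_sph (f : C(Sph n, ℝ)) : Integrable f (sphereMeasure n) :=
  f.continuous.integrable_of_hasCompactSupport (HasCompactSupport.of_compactSpace _)

/-- Integration with respect to the spherical Lebesgue measure. -/
def sphInt (n : ℕ) : C(Sph n, ℝ) →L[ℝ] ℝ :=
  LinearMap.mkContinuous
    { toFun := fun f => ∫ u, f u ∂(sphereMeasure n)
      map_add' := fun f g => integral_add (integrable_sph f) (integrable_sph g)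
      map_smul' := fun c f => integral_const_mul c f }
    ((sphereMeasure n).real univ) (fun f => by
      have := norm_integral_le_of_norm_le_const (μ := sphereMeasure n) (f := f) (C := ‖f‖)
        (ae_of_all _ f.norm_coe_le_norm)
      rwa [mul_comm] at this)

theorem sphInt_apply (f : C(Sph n, ℝ)) : sphInt n f = ∫ u, f u ∂(sphereMeasure n) := rfl

theorem sphInt_pull (e : Euc n ≃ₗᵢ[ℝ] Euc n) (f : C(Sph n, ℝ)) :
    sphInt n (pull e f) = sphInt n f := by
  have h := measurePreserving_sphMap e
  rw [sphInt_apply, sphInt_apply]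
  conv_rhs => rw [← h.map_eq]
  rw [integral_map h.measurable.aemeasurable f.continuous.aestronglyMeasurable]
  rfl

theorem eq_zero_of_sphInt_mul_self {f : C(Sph n, ℝ)} (hf : sphInt n (f * f) = 0) : f = 0 := by
  by_contra hne
  obtain ⟨u, hu⟩ := DFunLike.ne_iff.1 hne
  have h := Continuous.integral_pos_of_hasCompactSupport_nonneg_nonzero (μ := sphereMeasure n)
    (f := ⇑(f * f)) (x := u) (f * f).continuous (HasCompactSupport.of_compactSpace _)
    (fun u => mul_self_nonneg (f u)) (by simpa using hu)
  exact h.ne' hf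

/-! ### Rotations in a coordinate plane -/

/-- The linear isometry that is the rotation with matrix `!![a, -b; b, a]` on the plane with
orthonormal basis `e, f`, and the identity on the orthogonal complement. -/
def planeRotation (e f : Euc n) (he : ‖e‖ = 1) (hf : ‖f‖ = 1) (hef : inner ℝ e f = 0) (a b : ℝ)
    (hab : a ^ 2 + b ^ 2 = 1) : Euc n ≃ₗᵢ[ℝ] Euc n :=
  LinearIsometry.toLinearIsometryEquiv
    { toFun := fun v => v + ((a - 1) * inner ℝ e v - b * inner ℝ f v) • e +
        (b * inner ℝ e v + (a - 1) * inner ℝ f v) • f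
      map_add' := fun v w => by
        simp only [inner_add_right]; module
      map_smul' := fun c v => by
        simp only [real_inner_smul_right, RingHom.id_apply]; module
      norm_map' := fun v => by
        simp only [LinearMap.coe_mk, AddHom.coe_mk]
        refine (sq_eq_sq₀ (norm_nonneg _) (norm_nonneg _)).1 ?_
        have hfe : inner ℝ f e = 0 := by rw [real_inner_comm]; exact hef
        have hve : inner ℝ v e = inner ℝ e v := real_inner_comm _ _
        have hvf : inner ℝ v f = inner ℝ f v := real_inner_comm _ _
        rw [← real_inner_self_eq_norm_sq, ← real_inner_self_eq_norm_sq]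
        simp only [inner_add_left, inner_add_right, real_inner_smul_left, real_inner_smul_right,
          hef, hfe, hve, hvf, real_inner_self_eq_norm_sq e, real_inner_self_eq_norm_sq f, he, hf]
        linear_combination ((inner ℝ e v) ^ 2 + (inner ℝ f v) ^ 2) * hab } rfl

theorem planeRotation_apply (e f : Euc n) (he : ‖e‖ = 1) (hf : ‖f‖ = 1) (hef : inner ℝ e f = 0)
    (a b : ℝ) (hab : a ^ 2 + b ^ 2 = 1) (v : Euc n) :
    planeRotation e f he hf hef a b hab v = v + ((a - 1) * inner ℝ e v - b * inner ℝ f v) • e +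
      (b * inner ℝ e v + (a - 1) * inner ℝ f v) • f := rfl

/-! ### Polynomials on the sphere -/

theorem restrictSphere_apply (p : MvPolynomial (Fin n) ℝ) (u : Sph n) :
    restrictSphere n p u = MvPolynomial.eval (fun i => (u : Euc n) i) p := rfl

theorem restrictSphere_mul (p q : MvPolynomial (Fin n) ℝ) :
    restrictSphere n (p * q) = restrictSphere n p * restrictSphere n q := by
  ext u; simp [restrictSphere_apply]

theorem restrictSphere_eq_aeval (p : MvPolynomial (Fin n) ℝ) :
    restrictSphere n p = MvPolynomial.aeval (fun i => restrictSphere n (MvPolynomial.X i)) p := by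
  induction p using MvPolynomial.induction_on with
  | C a => ext u; simp [restrictSphere_apply]
  | add p q hp hq => simp [hp, hq]
  | mul_X p i hp => simp [restrictSphere_mul, hp]

theorem aeval_apply_sph (g : Fin n → C(Sph n, ℝ)) (p : MvPolynomial (Fin n) ℝ) (u : Sph n) :
    MvPolynomial.aeval g p u = MvPolynomial.eval (fun k => g k u) p := by
  induction p using MvPolynomial.induction_on with
  | C a => simp
  | add p q hp hq => simp [hp, hq]
  | mul_X p i hp => simp [hp]

theorem eval_aeval (g : Fin n → MvPolynomial (Fin n) ℝ) (p : MvPolynomial (Fin n) ℝ)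
    (x : Fin n → ℝ) : MvPolynomial.eval x (MvPolynomial.aeval g p) =
      MvPolynomial.eval (fun k => MvPolynomial.eval x (g k)) p := by
  induction p using MvPolynomial.induction_on with
  | C a => simp
  | add p q hp hq => rw [map_add, map_add, map_add, hp, hq]
  | mul_X p i hp => rw [map_mul, map_mul, map_mul, hp, MvPolynomial.aeval_X, MvPolynomial.eval_X]

/-- Applied with A = C(Sⁿ⁻¹): differentiating a curve in this algebra takes the place of
differentiation under the integral sign. -/
theorem hasDerivAt_aeval {A : Type*} [NormedCommRing A] [NormedAlgebra ℝ A]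
    {c : ℝ → Fin n → A} {c' : Fin n → A} {t : ℝ} (hc : ∀ i, HasDerivAt (fun s => c s i) (c' i) t)
    (p : MvPolynomial (Fin n) ℝ) :
    HasDerivAt (fun s => MvPolynomial.aeval (c s) p)
      (∑ i, MvPolynomial.aeval (c t) (MvPolynomial.pderiv i p) * c' i) t := by
  induction p using MvPolynomial.induction_on with
  | C a => simpa using hasDerivAt_const t (algebraMap ℝ A a)
  | add p q hp hq => simpa [add_mul, Finset.sum_add_distrib] using hp.fun_add hq
  | mul_X p j hp =>
    have := hp.fun_mul (hc j)
    simp only [map_mul, MvPolynomial.aeval_X]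
    convert this using 1
    simp only [MvPolynomial.pderiv_mul, MvPolynomial.pderiv_X, map_add, map_mul,
      MvPolynomial.aeval_X, add_mul, Finset.sum_add_distrib, Finset.sum_mul]
    congr 1
    · exact Finset.sum_congr rfl fun i _ => by ring
    · rw [Finset.sum_eq_single j]
      · simp
      · intro i _ hi; simp [hi.symm]
      · simp

/-- The generator `xᵢ∂ⱼ - xⱼ∂ᵢ` of the rotations in a coordinate plane. -/
def rotGen (i j : Fin n) (p : MvPolynomial (Fin n) ℝ) : MvPolynomial (Fin n) ℝ :=
  MvPolynomial.X i * MvPolynomial.pderiv j p - MvPolynomial.X j * MvPolynomial.pderiv i p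

theorem restrictSphere_X_apply (i : Fin n) (u : Sph n) :
    restrictSphere n (MvPolynomial.X i) u = (u : Euc n) i := by simp [restrictSphere_apply]

/-- The integral of p over the sphere does not change when p is composed with the rotation by t in
the plane of coordinates i, j. The derivative at t = 0 is the integral of `rotGen i j p`. -/
theorem sphInt_rotGen (i j : Fin n) (p : MvPolynomial (Fin n) ℝ) :
    sphInt n (restrictSphere n (rotGen i j p)) = 0 := by
  by_cases hij : i = j
  · subst hij; simp [rotGen]
  let x : Fin n → C(Sph n, ℝ) := fun i => restrictSphere n (MvPolynomial.X i)
  -- `c t k` is the k-th coordinate of the rotated point, as a function on the sphere; `c'` is the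
  -- velocity at t = 0.
  let c : ℝ → Fin n → C(Sph n, ℝ) := fun t k => x k +
    (((Real.cos t - 1) • x i - Real.sin t • x j) * (Pi.single i 1 : Fin n → C(Sph n, ℝ)) k +
      (Real.sin t • x i + (Real.cos t - 1) • x j) * (Pi.single j 1 : Fin n → C(Sph n, ℝ)) k)
  let c' : Fin n → C(Sph n, ℝ) := fun k =>
    (((-Real.sin 0) • x i - Real.cos 0 • x j) * (Pi.single i 1 : Fin n → C(Sph n, ℝ)) k +
      (Real.cos 0 • x i + (-Real.sin 0) • x j) * (Pi.single j 1 : Fin n → C(Sph n, ℝ)) k)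
  have hc : ∀ k, HasDerivAt (fun t => c t k) (c' k) 0 := by
    intro k
    have h1 := (Real.hasDerivAt_cos 0).sub_const 1
    have h2 := Real.hasDerivAt_sin 0
    exact ((((h1.smul_const (x i)).sub (h2.smul_const (x j))).mul_const _).add
      (((h2.smul_const (x i)).add (h1.smul_const (x j))).mul_const _)).const_add _
  have hd := hasDerivAt_aeval hc p
  have hc0 : c 0 = x := by
    ext k : 1; simp [c]
  have hval : ∑ k, MvPolynomial.aeval (c 0) (MvPolynomial.pderiv k p) * c' k =
      restrictSphere n (rotGen i j p) := by
    rw [hc0, restrictSphere_eq_aeval]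
    simp only [c', Real.sin_zero, Real.cos_zero, neg_zero, zero_smul, one_smul, zero_sub, add_zero,
      mul_add, Finset.sum_add_distrib, rotGen, map_sub, map_mul, MvPolynomial.aeval_X]
    rw [Finset.sum_eq_single i, Finset.sum_eq_single j]
    · simp only [Pi.single_eq_same]; ring
    · intro k _ hk; simp [hk]
    · simp
    · intro k _ hk; simp [hk]
    · simp
  have hconst : ∀ t, sphInt n (MvPolynomial.aeval (c t) p) = sphInt n (restrictSphere n p) := by
    intro t
    let e : Euc n := EuclideanSpace.single i 1
    let f : Euc n := EuclideanSpace.single j 1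
    have he : ‖e‖ = 1 := by simp [e]
    have hf : ‖f‖ = 1 := by simp [f]
    have hef : inner ℝ e f = 0 := by simp [e, f, EuclideanSpace.inner_single_left, hij]
    rw [← sphInt_pull (planeRotation e f he hf hef (Real.cos t) (Real.sin t)
      (Real.cos_sq_add_sin_sq t)) (restrictSphere n p)]
    congr 1
    ext u
    rw [pull_apply, restrictSphere_apply]
    rw [aeval_apply_sph]
    congr 2
    ext k
    rw [coe_sphMap, planeRotation_apply]
    simp only [c, x, e, f, ContinuousMap.add_apply, ContinuousMap.mul_apply, ContinuousMap.sub_apply,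
      ContinuousMap.smul_apply, restrictSphere_X_apply, EuclideanSpace.inner_single_left,
      PiLp.add_apply, PiLp.smul_apply, PiLp.single_apply, Pi.single_apply, smul_eq_mul]
    split_ifs <;> norm_num
    ring
  have h0 : HasDerivAt (fun t => sphInt n (MvPolynomial.aeval (c t) p))
      (sphInt n (restrictSphere n (rotGen i j p))) 0 := by
    rw [← hval]
    exact (sphInt n).hasFDerivAt.comp_hasDerivAt 0 hd
  simp only [hconst] at h0
  exact h0.unique (hasDerivAt_const _ _)

open MvPolynomial (X C pderiv IsHomogeneous)

/-! ### The second order rotation operator -/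

theorem polyLaplacian_apply (p : MvPolynomial (Fin n) ℝ) :
    polyLaplacian n p = ∑ i, pderiv i (pderiv i p) := by
  simp [polyLaplacian]

theorem eq_C_of_isHomogeneous_zero {p : MvPolynomial (Fin n) ℝ} (hp : p.IsHomogeneous 0) :
    p = C (p.coeff 0) := by
  rwa [← MvPolynomial.totalDegree_zero_iff_isHomogeneous,
    MvPolynomial.totalDegree_eq_zero_iff_eq_C] at hp

/-- The squared norm as a polynomial. -/
def normSqPoly (n : ℕ) : MvPolynomial (Fin n) ℝ := ∑ i, X i ^ 2

theorem isHomogeneous_normSqPoly : (normSqPoly n).IsHomogeneous 2 :=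
  MvPolynomial.IsHomogeneous.sum _ _ _ fun i _ => MvPolynomial.isHomogeneous_X_pow i 2

theorem eval_normSqPoly (x : Euc n) :
    MvPolynomial.eval (fun i => x i) (normSqPoly n) = ‖x‖ ^ 2 := by
  simp [normSqPoly, EuclideanSpace.norm_sq_eq]

theorem restrictSphere_normSqPoly_mul (p : MvPolynomial (Fin n) ℝ) :
    restrictSphere n (normSqPoly n * p) = restrictSphere n p := by
  ext u
  rw [restrictSphere_apply, map_mul, eval_normSqPoly, norm_sph]
  simp [restrictSphere_apply]

theorem isHomogeneous_polyLaplacian {p : MvPolynomial (Fin n) ℝ} {k : ℕ}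
    (hp : p.IsHomogeneous k) : (polyLaplacian n p).IsHomogeneous (k - 1 - 1) := by
  rw [polyLaplacian_apply]
  exact MvPolynomial.IsHomogeneous.sum _ _ _ fun i _ => hp.pderiv.pderiv

theorem rotGen_mul (i j : Fin n) (p q : MvPolynomial (Fin n) ℝ) :
    rotGen i j (p * q) = rotGen i j p * q + p * rotGen i j q := by
  simp only [rotGen, MvPolynomial.pderiv_mul]; ring

/-- The two Kronecker terms only matter for i = j, where they make the right side vanish; with them
the formula can be summed over all pairs. -/
theorem rotGen_rotGen (i j : Fin n) (p : MvPolynomial (Fin n) ℝ) :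
    rotGen i j (rotGen i j p) =
      X i ^ 2 * pderiv j (pderiv j p) + X j ^ 2 * pderiv i (pderiv i p)
      - X i * X j * pderiv j (pderiv i p) - X i * X j * pderiv i (pderiv j p)
      - X i * pderiv i p - X j * pderiv j p
      + ((Pi.single j 1 : Fin n → MvPolynomial (Fin n) ℝ) i * (X i * pderiv j p)
      + (Pi.single i 1 : Fin n → MvPolynomial (Fin n) ℝ) j * (X j * pderiv i p)) := by
  simp only [rotGen, map_sub, MvPolynomial.pderiv_mul, MvPolynomial.pderiv_X, Pi.single_eq_same]
  ring

/-- Euler's identity, differentiated once and then used again. -/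
theorem sum_X_mul_X_mul_pderiv {p : MvPolynomial (Fin n) ℝ} {k : ℕ} (hp : p.IsHomogeneous k) :
    ∑ i, ∑ j, X i * X j * pderiv i (pderiv j p) = ((k : ℝ) ^ 2 - k) • p := by
  have h1 := hp.sum_X_mul_pderiv
  have h2 : ∀ i, ∑ j, X i * X j * pderiv i (pderiv j p) = (k : ℝ) • (X i * pderiv i p)
      - X i * pderiv i p := by
    intro i
    have h3 : pderiv i (∑ j, X j * pderiv j p) = ∑ j, X j * pderiv i (pderiv j p) + pderiv i p := by
      rw [map_sum]
      simp only [MvPolynomial.pderiv_mul, MvPolynomial.pderiv_X, Finset.sum_add_distrib]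
      rw [add_comm, Finset.sum_eq_single (s := Finset.univ) (a := i)
        (f := fun j => (Pi.single i 1 : Fin n → MvPolynomial (Fin n) ℝ) j * pderiv j p)]
      · simp
      · intro j _ hj; simp [hj]
      · simp
    rw [h1, map_nsmul] at h3
    simp only [mul_assoc, ← Finset.mul_sum]
    rw [← sub_eq_iff_eq_add] at h3
    rw [← h3, mul_sub, Nat.cast_smul_eq_nsmul, mul_smul_comm]
  simp only [h2, Finset.sum_sub_distrib, ← Finset.smul_sum, h1]
  rw [← Nat.cast_smul_eq_nsmul ℝ]
  module

/-- This is the Laplace–Beltrami operator, doubled because ordered pairs are summed. Harmonic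
polynomials of degree k are eigenvectors with eigenvalue -2k(k + n - 2). -/
theorem sum_rotGen_rotGen {p : MvPolynomial (Fin n) ℝ} {k : ℕ} (hp : p.IsHomogeneous k) :
    ∑ i, ∑ j, rotGen i j (rotGen i j p) =
      (2 : ℝ) • (normSqPoly n * polyLaplacian n p - ((k : ℝ) * (k + n - 2)) • p) := by
  have h1 : ∑ i, X i * pderiv i p = (k : ℝ) • p := by
    rw [hp.sum_X_mul_pderiv, Nat.cast_smul_eq_nsmul]
  have h2 := sum_X_mul_X_mul_pderiv hp
  have h3 : ∑ i, ∑ j, X i * X j * pderiv j (pderiv i p) = ((k : ℝ) ^ 2 - k) • p := by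
    rw [Finset.sum_comm, ← h2]
    exact Finset.sum_congr rfl fun i _ => Finset.sum_congr rfl fun j _ => by ring
  have h4 : ∑ i : Fin n, ∑ j : Fin n, X i ^ 2 * pderiv j (pderiv j p) =
      normSqPoly n * polyLaplacian n p := by
    rw [normSqPoly, polyLaplacian_apply, Finset.sum_mul_sum]
  have h5 : ∑ i : Fin n, ∑ j : Fin n, X j ^ 2 * pderiv i (pderiv i p) =
      normSqPoly n * polyLaplacian n p := by
    rw [Finset.sum_comm, h4]
  have h6 : ∑ i : Fin n, ∑ _j : Fin n, X i * pderiv i p = ((n : ℝ) * k) • p := by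
    simp only [Finset.sum_const, Finset.card_univ, Fintype.card_fin, ← Finset.smul_sum, h1]
    rw [← Nat.cast_smul_eq_nsmul ℝ, smul_smul]
  have h7 : ∑ _i : Fin n, ∑ j : Fin n, X j * pderiv j p = ((n : ℝ) * k) • p := by
    rw [Finset.sum_comm, h6]
  have h8 : ∑ i : Fin n, ∑ j : Fin n,
      (Pi.single j 1 : Fin n → MvPolynomial (Fin n) ℝ) i * (X i * pderiv j p) = (k : ℝ) • p := by
    rw [← h1]
    refine Finset.sum_congr rfl fun i _ => ?_
    rw [Finset.sum_eq_single i]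
    · simp
    · intro j _ hj; simp [hj.symm]
    · simp
  have h9 : ∑ i : Fin n, ∑ j : Fin n,
      (Pi.single i 1 : Fin n → MvPolynomial (Fin n) ℝ) j * (X j * pderiv i p) = (k : ℝ) • p := by
    rw [Finset.sum_comm, h8]
  simp only [rotGen_rotGen, Finset.sum_add_distrib, Finset.sum_sub_distrib]
  rw [h2, h3, h4, h5, h6, h7, h8, h9]
  module

/-- Integration by parts: `rotGen` is a derivation whose values have integral zero. Two applications
make the second order operator self-adjoint. -/
theorem sphInt_rotGen_mul (i j : Fin n) (p q : MvPolynomial (Fin n) ℝ) :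
    sphInt n (restrictSphere n (rotGen i j p * q)) =
      -sphInt n (restrictSphere n (p * rotGen i j q)) := by
  have := sphInt_rotGen i j (p * q)
  rw [rotGen_mul, map_add, map_add] at this
  linarith

theorem sphInt_sum_rotGen_mul (p q : MvPolynomial (Fin n) ℝ) :
    sphInt n (restrictSphere n ((∑ i, ∑ j, rotGen i j (rotGen i j p)) * q)) =
      sphInt n (restrictSphere n (p * ∑ i, ∑ j, rotGen i j (rotGen i j q))) := by
  simp only [Finset.sum_mul, Finset.mul_sum, map_sum]
  refine Finset.sum_congr rfl fun i _ => Finset.sum_congr rfl fun j _ => ?_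
  rw [sphInt_rotGen_mul, sphInt_rotGen_mul, neg_neg]

/-- Harmonic homogeneous polynomials are orthogonal to polynomials of lower degree. -/
theorem sphInt_harmonic_mul (hn : 2 ≤ n) {m : ℕ} {f : MvPolynomial (Fin n) ℝ}
    (hf : f ∈ harmonicPoly n m) {k : ℕ} (hk : k < m) {q : MvPolynomial (Fin n) ℝ}
    (hq : q.IsHomogeneous k) : sphInt n (restrictSphere n (f * q)) = 0 := by
  induction k using Nat.strong_induction_on generalizing q with
  | _ k ih =>
  have hf1 : f.IsHomogeneous m := hf.1
  have hf2 : polyLaplacian n f = 0 := hf.2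
  -- The Laplacian of q falls under the induction hypothesis. Constants are separate, since the
  -- truncated degree k - 1 - 1 is not smaller than k = 0.
  have h0 : sphInt n (restrictSphere n (f * polyLaplacian n q)) = 0 := by
    rcases Nat.eq_zero_or_pos k with rfl | hpos
    · rw [eq_C_of_isHomogeneous_zero hq]
      simp [polyLaplacian_apply]
    · exact ih _ (by omega) (by omega) (isHomogeneous_polyLaplacian hq)
  have h1 := sphInt_sum_rotGen_mul f q
  rw [sum_rotGen_rotGen hf1, sum_rotGen_rotGen hq, hf2, mul_zero, zero_sub] at h1
  have e1 : (2 : ℝ) • -(((m : ℝ) * (m + n - 2)) • f) * q =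
      (-2 * ((m : ℝ) * (m + n - 2))) • (f * q) := by
    simp only [smul_neg, neg_mul, MvPolynomial.smul_eq_C_mul, map_neg, map_mul]; ring
  have e2 : f * (2 : ℝ) • (normSqPoly n * polyLaplacian n q - ((k : ℝ) * (k + n - 2)) • q) =
      (2 : ℝ) • (normSqPoly n * (f * polyLaplacian n q)) -
        (2 * ((k : ℝ) * (k + n - 2))) • (f * q) := by
    simp only [MvPolynomial.smul_eq_C_mul, map_mul]; ring
  rw [e1, e2] at h1
  simp only [map_smul, map_sub, restrictSphere_normSqPoly_mul, h0, smul_eq_mul] at h1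
  -- The eigenvalues for k and m differ, so self-adjointness forces orthogonality.
  have hlt : (k : ℝ) * (k + n - 2) < m * (m + n - 2) := by
    have a1 : (k : ℝ) + 1 ≤ m := by exact_mod_cast hk
    have a2 : (2 : ℝ) ≤ n := by exact_mod_cast hn
    have a3 : (0 : ℝ) ≤ k := by positivity
    nlinarith
  have : (m * (m + n - 2) - (k : ℝ) * (k + n - 2)) * sphInt n (restrictSphere n (f * q)) = 0 := by
    linarith
  exact (mul_eq_zero.1 this).resolve_left (by linarith)

/-! ### Homogeneous polynomials on the sphere -/

theorem eval_smul_of_isHomogeneous {p : MvPolynomial (Fin n) ℝ} {k : ℕ} (hp : p.IsHomogeneous k)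
    (c : ℝ) (x : Fin n → ℝ) :
    MvPolynomial.eval (fun i => c * x i) p = c ^ k * MvPolynomial.eval x p := by
  rw [MvPolynomial.eval_eq, MvPolynomial.eval_eq, Finset.mul_sum]
  refine Finset.sum_congr rfl fun d hd => ?_
  have : ∏ i ∈ d.support, c ^ d i = c ^ k := by
    rw [Finset.prod_pow_eq_pow_sum, ← hp.degree_eq_sum_deg_support hd]
  simp only [mul_pow, Finset.prod_mul_distrib, this]
  ring

theorem eq_zero_of_restrictSphere_eq_zero [Nonempty (Sph n)] {p : MvPolynomial (Fin n) ℝ} {k : ℕ}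
    (hp : p.IsHomogeneous k) (h : restrictSphere n p = 0) : p = 0 := by
  obtain ⟨u₀⟩ := ‹Nonempty (Sph n)›
  refine hp.eq_zero_of_forall_eval_eq_zero fun r => ?_
  let x : Euc n := WithLp.toLp 2 r
  have hx : r = fun i => ‖x‖ * (toSph u₀ x : Euc n) i := by
    ext i
    have := congrArg (fun y : Euc n => y i) (norm_smul_toSph u₀ x)
    simpa [x] using this.symm
  rw [hx, eval_smul_of_isHomogeneous hp]
  have := DFunLike.congr_fun h (toSph u₀ x)
  rw [restrictSphere_apply] at this
  rw [this]; simp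

/-- The restrictions to the sphere of homogeneous polynomials of degree `k`. -/
def polySphere (n k : ℕ) : Submodule ℝ C(Sph n, ℝ) :=
  (MvPolynomial.homogeneousSubmodule (Fin n) ℝ k).map (restrictSphere n)

theorem sphericalHarmonic_le_polySphere (m : ℕ) : sphericalHarmonic n m ≤ polySphere n m :=
  Submodule.map_mono inf_le_left

instance finiteDimensional_polySphere (k : ℕ) : FiniteDimensional ℝ (polySphere n k) := by
  have h : FiniteDimensional ℝ (MvPolynomial.homogeneousSubmodule (Fin n) ℝ k) :=
    Module.Finite.iff_fg.mpr (MvPolynomial.homogeneousSubmodule_fg (Fin n) ℝ k)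
  unfold polySphere
  infer_instance

theorem sphInt_sphericalHarmonic_mul (hn : 2 ≤ n) {m k : ℕ} (hk : k < m) {f g : C(Sph n, ℝ)}
    (hf : f ∈ sphericalHarmonic n m) (hg : g ∈ polySphere n k) : sphInt n (f * g) = 0 := by
  obtain ⟨p, hp, rfl⟩ := hf
  obtain ⟨q, hq, rfl⟩ := hg
  rw [← restrictSphere_mul]
  exact sphInt_harmonic_mul hn hp hk hq

theorem nonempty_sph (hn : 2 ≤ n) : Nonempty (Sph n) :=
  ⟨⟨EuclideanSpace.single ⟨0, by omega⟩ 1, by simp⟩⟩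

/-- Fischer's decomposition of homogeneous polynomials. -/
theorem exists_harmonic_add (hn : 2 ≤ n) {k : ℕ} {p : MvPolynomial (Fin n) ℝ}
    (hp : p.IsHomogeneous (k + 2)) : ∃ h ∈ harmonicPoly n (k + 2),
      ∃ q : MvPolynomial (Fin n) ℝ, q.IsHomogeneous k ∧ p = h + normSqPoly n * q := by
  have := nonempty_sph hn
  let V := MvPolynomial.homogeneousSubmodule (Fin n) ℝ k
  have hV : FiniteDimensional ℝ V :=
    Module.Finite.iff_fg.mpr (MvPolynomial.homogeneousSubmodule_fg (Fin n) ℝ k)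
  have hmul : ∀ q : MvPolynomial (Fin n) ℝ, q.IsHomogeneous k →
      (normSqPoly n * q).IsHomogeneous (k + 2) := fun q hq => by
    rw [add_comm]; exact isHomogeneous_normSqPoly.mul hq
  let T : V →ₗ[ℝ] V := ((polyLaplacian n) ∘ₗ LinearMap.mulLeft ℝ (normSqPoly n)).restrict
    (fun q hq => isHomogeneous_polyLaplacian (hmul q hq))
  -- If ‖x‖² q is harmonic, it is orthogonal to q, which has lower degree. Since ‖x‖ = 1 on the
  -- sphere, the integral of q² vanishes.
  have hT : Function.Injective T := by
    rw [← LinearMap.ker_eq_bot, LinearMap.ker_eq_bot']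
    rintro ⟨q, hq⟩ h
    have h' : polyLaplacian n (normSqPoly n * q) = 0 := congrArg Subtype.val h
    have hh : normSqPoly n * q ∈ harmonicPoly n (k + 2) := ⟨hmul q hq, h'⟩
    have h0 := sphInt_harmonic_mul hn hh (by omega) hq
    rw [mul_assoc, restrictSphere_normSqPoly_mul, restrictSphere_mul] at h0
    exact Subtype.ext (eq_zero_of_restrictSphere_eq_zero hq (eq_zero_of_sphInt_mul_self h0))
  have hTs := LinearMap.injective_iff_surjective.1 hT
  obtain ⟨⟨q, hq⟩, h⟩ := hTs ⟨polyLaplacian n p, isHomogeneous_polyLaplacian hp⟩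
  have h' : polyLaplacian n (normSqPoly n * q) = polyLaplacian n p := congrArg Subtype.val h
  refine ⟨p - normSqPoly n * q, ⟨hp.sub (hmul q hq), ?_⟩, q, hq, by ring⟩
  rw [SetLike.mem_coe, LinearMap.mem_ker, map_sub, h', sub_self]

theorem polySphere_le_sup (hn : 2 ≤ n) (k : ℕ) :
    polySphere n (k + 2) ≤ sphericalHarmonic n (k + 2) ⊔ polySphere n k := by
  rintro _ ⟨p, hp, rfl⟩
  obtain ⟨h, hh, q, hq, rfl⟩ := exists_harmonic_add hn hp
  rw [map_add, restrictSphere_normSqPoly_mul]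
  exact Submodule.add_mem_sup ⟨h, hh, rfl⟩ ⟨q, hq, rfl⟩

theorem polySphere_eq_of_lt_two {k : ℕ} (hk : k < 2) : polySphere n k = sphericalHarmonic n k := by
  refine le_antisymm ?_ (sphericalHarmonic_le_polySphere k)
  rintro _ ⟨p, hp, rfl⟩
  refine ⟨p, ⟨hp, ?_⟩, rfl⟩
  rw [SetLike.mem_coe, LinearMap.mem_ker, polyLaplacian_apply]
  refine Finset.sum_eq_zero fun i _ => ?_
  have : (pderiv i p).IsHomogeneous 0 := by
    have := MvPolynomial.IsHomogeneous.pderiv (i := i) hp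
    rwa [show k - 1 = 0 by omega] at this
  rw [eq_C_of_isHomogeneous_zero this, MvPolynomial.pderiv_C]

/-- Iterating Fischer's decomposition lowers the degree by two each time, because ‖x‖² is 1 on the
sphere; hence only orders of the parity of k occur. -/
theorem polySphere_le_of_forall (hn : 2 ≤ n) {D : Submodule ℝ C(Sph n, ℝ)} (k : ℕ)
    (h : ∀ j, j % 2 = k % 2 → sphericalHarmonic n j ≤ D) : polySphere n k ≤ D := by
  induction k using Nat.strong_induction_on with
  | _ k ih =>
  rcases lt_or_ge k 2 with hk | hk
  · rw [polySphere_eq_of_lt_two hk]; exact h k rfl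
  · obtain ⟨k, rfl⟩ := Nat.exists_eq_add_of_le' hk
    exact (polySphere_le_sup hn k).trans (sup_le (h _ rfl)
      (ih k (by omega) fun j hj => h j (by omega)))

/-- Degree and orthogonality are visibly preserved by linear isometries. This gives the invariance
of ℋₘ without transforming the Laplacian. -/
theorem mem_sphericalHarmonic_iff (hn : 2 ≤ n) {m : ℕ} {f : C(Sph n, ℝ)} :
    f ∈ sphericalHarmonic n m ↔ f ∈ polySphere n m ∧
      ∀ k < m, ∀ g ∈ polySphere n k, sphInt n (f * g) = 0 := by
  refine ⟨fun hf => ⟨sphericalHarmonic_le_polySphere m hf, fun k hk g hg =>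
    sphInt_sphericalHarmonic_mul hn hk hf hg⟩, ?_⟩
  rintro ⟨hf, h⟩
  rcases lt_or_ge m 2 with hm | hm
  · rwa [← polySphere_eq_of_lt_two hm]
  obtain ⟨m, rfl⟩ := Nat.exists_eq_add_of_le' hm
  obtain ⟨a, ha, b, hb, rfl⟩ := Submodule.mem_sup.1 (polySphere_le_sup hn m hf)
  -- The component b of degree m is orthogonal to a + b by hypothesis and to a by harmonicity, hence
  -- to itself.
  have h1 := h m (by omega) b hb
  rw [add_mul, map_add, sphInt_sphericalHarmonic_mul hn (by omega) ha hb, zero_add] at h1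
  rw [eq_zero_of_sphInt_mul_self h1, add_zero]
  exact ha

theorem pull_mem_polySphere (e : Euc n ≃ₗᵢ[ℝ] Euc n) {k : ℕ} {f : C(Sph n, ℝ)}
    (hf : f ∈ polySphere n k) : pull e f ∈ polySphere n k := by
  obtain ⟨p, hp, rfl⟩ := hf
  refine ⟨MvPolynomial.aeval (fun i => ∑ j, C ((e (EuclideanSpace.single j 1)) i) * X j) p, ?_, ?_⟩
  · have := MvPolynomial.IsHomogeneous.aeval (n := 1) hp
      (fun i => ∑ j, C ((e (EuclideanSpace.single j 1)) i) * X j)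
      (fun i => MvPolynomial.IsHomogeneous.sum _ _ _ fun j _ =>
        MvPolynomial.isHomogeneous_C_mul_X _ j)
    rwa [one_mul] at this
  · ext u
    rw [restrictSphere_apply, pull_apply, restrictSphere_apply, eval_aeval]
    congr 2
    ext i
    have hu : (u : Euc n) = ∑ j, (u : Euc n) j • EuclideanSpace.single j (1 : ℝ) := by
      ext i; simp [Pi.single_apply]
    conv_rhs => rw [coe_sphMap, hu, map_sum]
    simp [mul_comm]

theorem pull_mem_sphericalHarmonic (hn : 2 ≤ n) (e : Euc n ≃ₗᵢ[ℝ] Euc n) {m : ℕ} {f : C(Sph n, ℝ)}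
    (hf : f ∈ sphericalHarmonic n m) : pull e f ∈ sphericalHarmonic n m := by
  rw [mem_sphericalHarmonic_iff hn] at hf ⊢
  refine ⟨pull_mem_polySphere e hf.1, fun k hk g hg => ?_⟩
  rw [← pull_pull_symm e g, ← pull_mul, sphInt_pull]
  exact hf.2 k hk _ (pull_mem_polySphere e.symm hg)

theorem sphericalHarmonic_ne_bot (hn : 2 ≤ n) (m : ℕ) : sphericalHarmonic n m ≠ ⊥ := by
  have := nonempty_sph hn
  obtain ⟨h, hh, h0⟩ : ∃ h ∈ harmonicPoly n m, h ≠ 0 := by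
    let i₀ : Fin n := ⟨0, by omega⟩
    let i₁ : Fin n := ⟨1, by omega⟩
    have hX : (X i₀ ^ m : MvPolynomial (Fin n) ℝ).IsHomogeneous m :=
      MvPolynomial.isHomogeneous_X_pow i₀ m
    rcases lt_or_ge m 2 with hm | hm
    · have hmem : restrictSphere n (X i₀ ^ m) ∈ sphericalHarmonic n m := by
        rw [← polySphere_eq_of_lt_two hm]; exact ⟨_, hX, rfl⟩
      obtain ⟨h, hh, e⟩ := hmem
      refine ⟨h, hh, ?_⟩
      rintro rfl
      rw [map_zero] at e
      exact pow_ne_zero m (MvPolynomial.X_ne_zero i₀) (eq_zero_of_restrictSphere_eq_zero hX e.symm)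
    · obtain ⟨m, rfl⟩ := Nat.exists_eq_add_of_le' hm
      obtain ⟨h, hh, q, hq, e⟩ := exists_harmonic_add hn hX
      refine ⟨h, hh, ?_⟩
      rintro rfl
      -- An isotropic vector (1, i, 0, …): if the harmonic part were zero, the power of X i₀ would
      -- be a multiple of ∑ xⱼ², yet it takes the value 1 at z, where ∑ zⱼ² = 0.
      let z : Fin n → ℂ := Pi.single i₀ 1 + Pi.single i₁ Complex.I
      have hi : i₀ ≠ i₁ := by simp [i₀, i₁]
      have h1 := congrArg (MvPolynomial.aeval z) e
      have h2 : MvPolynomial.aeval z (normSqPoly n) = 0 := by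
        have h3 : ∀ i, z i ^ 2 = (Pi.single i₀ 1 : Fin n → ℂ) i + (Pi.single i₁ (-1) : Fin n → ℂ) i := by
          intro i
          by_cases h0 : i = i₀
          · subst h0; simp [z, hi]
          · by_cases h1 : i = i₁
            · subst h1; simp [z, hi.symm]
            · simp [z, h0, h1]
        simp [normSqPoly, h3, Finset.sum_add_distrib]
      rw [zero_add, map_mul, h2, zero_mul, map_pow, MvPolynomial.aeval_X] at h1
      simp [z, hi] at h1
  intro hbot
  have : restrictSphere n h ∈ sphericalHarmonic n m := ⟨h, hh, rfl⟩
  rw [hbot, Submodule.mem_bot] at this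
  exact h0 (eq_zero_of_restrictSphere_eq_zero hh.1 this)

/-! ### Duality in finite-dimensional spaces of functions on the sphere -/

/-- Riesz representation: the scalar product is definite on continuous functions, so the induced map
from W to its dual is injective, hence bijective in finite dimension. -/
theorem exists_sphInt_mul_eq (W : Submodule ℝ C(Sph n, ℝ)) [FiniteDimensional ℝ W]
    (φ : W →ₗ[ℝ] ℝ) : ∃ w ∈ W, ∀ v : W, sphInt n (w * v) = φ v := by
  let T : W →ₗ[ℝ] Module.Dual ℝ W := LinearMap.mk₂ ℝ (fun v w : W => sphInt n ((v : C(Sph n, ℝ)) * w))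
    (fun a b c => by simp [add_mul]) (fun c a b => by simp)
    (fun a b c => by simp [mul_add]) (fun c a b => by simp)
  have hT : Function.Injective T := by
    rw [← LinearMap.ker_eq_bot, LinearMap.ker_eq_bot']
    intro w hw
    exact Subtype.ext (eq_zero_of_sphInt_mul_self (LinearMap.congr_fun hw w))
  obtain ⟨w, hw⟩ := (LinearMap.injective_iff_surjective_of_finrank_eq_finrank
    Subspace.dual_finrank_eq.symm).1 hT φ
  exact ⟨w, w.2, fun v => LinearMap.congr_fun hw v⟩

theorem exists_sphInt_sub_mul_eq_zero (W : Submodule ℝ C(Sph n, ℝ)) [FiniteDimensional ℝ W]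
    (f : C(Sph n, ℝ)) : ∃ w ∈ W, ∀ v ∈ W, sphInt n ((f - w) * v) = 0 := by
  obtain ⟨w, hw, h⟩ := exists_sphInt_mul_eq W
    (((sphInt n).toLinearMap ∘ₗ LinearMap.mulLeft ℝ f) ∘ₗ W.subtype)
  refine ⟨w, hw, fun v hv => ?_⟩
  have := h ⟨v, hv⟩
  simp only [LinearMap.comp_apply, LinearMap.mulLeft_apply, Submodule.subtype_apply,
    ContinuousLinearMap.coe_coe] at this
  rw [sub_mul, map_sub, this, sub_self]

/-- Replaces the L² projection by plain orthogonality, the only form used below. -/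
theorem harmonicProj_eq_zero_iff {m : ℕ} {f : C(Sph n, ℝ)} :
    harmonicProj n m f = 0 ↔ ∀ q ∈ sphericalHarmonic n m, sphInt n (f * q) = 0 := by
  unfold harmonicProj
  rw [LinearMap.comp_apply, LinearMap.comp_apply, LinearEquiv.coe_coe,
    LinearEquiv.map_eq_zero_iff, ContinuousLinearMap.coe_coe,
    Submodule.orthogonalProjectionOnto_eq_zero_iff, Submodule.mem_orthogonal]
  constructor
  · intro h q hq
    have := h _ ⟨q, hq, rfl⟩
    rw [← this]
    exact (ContinuousMap.inner_toLp (𝕜 := ℝ) (sphereMeasure n) q f).symm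
  · rintro h _ ⟨q, hq, rfl⟩
    rw [← h q hq]
    exact ContinuousMap.inner_toLp (𝕜 := ℝ) (sphereMeasure n) q f

/-! ### Rotations and reflections -/

/-- A linear isometry is a rotation if its determinant is one. -/
def IsRotation (e : Euc n ≃ₗᵢ[ℝ] Euc n) : Prop :=
  LinearMap.det (e.toLinearEquiv : Euc n →ₗ[ℝ] Euc n) = 1

theorem det_eq_one_or (e : Euc n ≃ₗᵢ[ℝ] Euc n) :
    LinearMap.det (e.toLinearEquiv : Euc n →ₗ[ℝ] Euc n) = 1 ∨
      LinearMap.det (e.toLinearEquiv : Euc n →ₗ[ℝ] Euc n) = -1 := by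
  let b := EuclideanSpace.basisFun (Fin n) ℝ
  have h := (Matrix.det_of_mem_unitary (e.toMatrix_mem_unitaryGroup b b)).1
  rw [LinearMap.det_toMatrix, star_trivial] at h
  exact mul_self_eq_one_iff.1 h

theorem det_trans (e e' : Euc n ≃ₗᵢ[ℝ] Euc n) :
    LinearMap.det ((e.trans e').toLinearEquiv : Euc n →ₗ[ℝ] Euc n) =
      LinearMap.det (e'.toLinearEquiv : Euc n →ₗ[ℝ] Euc n) *
        LinearMap.det (e.toLinearEquiv : Euc n →ₗ[ℝ] Euc n) := by
  rw [← LinearMap.det_comp]; rfl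

theorem IsRotation.symm {e : Euc n ≃ₗᵢ[ℝ] Euc n} (he : IsRotation e) : IsRotation e.symm := by
  have h := det_trans e e.symm
  unfold IsRotation at *
  rw [he, mul_one] at h
  rw [← h]
  have : (e.trans e.symm).toLinearEquiv = LinearEquiv.refl ℝ (Euc n) := by ext; simp
  rw [this]; simp

theorem det_reflection_orthogonal_singleton {w : Euc n} (hw : w ≠ 0) :
    LinearMap.det ((Submodule.reflection (ℝ ∙ w)ᗮ).toLinearEquiv : Euc n →ₗ[ℝ] Euc n) = -1 := by
  have := Submodule.det_reflection (ℝ ∙ w)ᗮ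
  rw [Submodule.orthogonal_orthogonal, finrank_span_singleton hw, pow_one] at this
  exact this

theorem exists_norm_eq_one_inner_eq_zero (hn : 2 ≤ n) (x : Euc n) :
    ∃ v : Euc n, ‖v‖ = 1 ∧ inner ℝ x v = 0 := by
  have : (ℝ ∙ x)ᗮ ≠ ⊥ := by
    intro h
    have h1 := Submodule.finrank_add_finrank_orthogonal (ℝ ∙ x)
    rw [h, finrank_bot, finrank_euclideanSpace_fin] at h1
    have := finrank_span_le_card (R := ℝ) ({x} : Set (Euc n))
    simp at this
    omega
  obtain ⟨w, hw, hw0⟩ := Submodule.exists_mem_ne_zero_of_ne_bot this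
  refine ⟨‖w‖⁻¹ • w, by simp [norm_smul, hw0], ?_⟩
  rw [real_inner_smul_right, Submodule.mem_orthogonal_singleton_iff_inner_right.1 hw, mul_zero]

/-- For u ≠ x, reflect in the hyperplane orthogonal to u - x; for u = x, in any hyperplane through
u, which exists because n ≥ 2. -/
theorem exists_reflection_swap (hn : 2 ≤ n) (u x : Sph n) : ∃ σ : Euc n ≃ₗᵢ[ℝ] Euc n,
    LinearMap.det (σ.toLinearEquiv : Euc n →ₗ[ℝ] Euc n) = -1 ∧ sphMap σ u = x ∧ sphMap σ x = u := by
  by_cases h : u = x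
  · subst h
    obtain ⟨v, hv, hxv⟩ := exists_norm_eq_one_inner_eq_zero hn (u : Euc n)
    have hv0 : v ≠ 0 := by rintro rfl; simp at hv
    have hfix : sphMap (Submodule.reflection (ℝ ∙ v)ᗮ) u = u := by
      ext1
      rw [coe_sphMap, Submodule.reflection_mem_subspace_eq_self]
      rw [Submodule.mem_orthogonal_singleton_iff_inner_left]
      exact hxv
    exact ⟨_, det_reflection_orthogonal_singleton hv0, hfix, hfix⟩
  · have h1 : sphMap (Submodule.reflection (ℝ ∙ ((u : Euc n) - x))ᗮ) u = x := by
      ext1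
      rw [coe_sphMap, Submodule.reflection_sub (by rw [norm_sph, norm_sph])]
    refine ⟨_, det_reflection_orthogonal_singleton (sub_ne_zero.2 (Subtype.coe_ne_coe.2 h)),
      h1, ?_⟩
    have h2 := congrArg (sphMap (Submodule.reflection (ℝ ∙ ((u : Euc n) - x))ᗮ)) h1
    rw [← h2]
    ext1
    rw [coe_sphMap, coe_sphMap, Submodule.reflection_reflection]

/-- A rotation invariant kernel is, up to interchanging its arguments, invariant under improper
isometries. -/
theorem kernel_swap (hn : 2 ≤ n) {α : Type*} {Φ : Sph n → Sph n → α}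
    (hΦ : ∀ e, IsRotation e → ∀ u x, Φ (sphMap e u) (sphMap e x) = Φ u x)
    {s : Euc n ≃ₗᵢ[ℝ] Euc n} (hs : LinearMap.det (s.toLinearEquiv : Euc n →ₗ[ℝ] Euc n) = -1)
    (u x : Sph n) : Φ (sphMap s x) (sphMap s u) = Φ u x := by
  obtain ⟨σ, hσ, h1, h2⟩ := exists_reflection_swap hn u x
  -- With σ an improper isometry interchanging u and x, σ followed by s is a rotation taking the
  -- pair (u, x) to (s x, s u).
  rw [← hΦ (σ.trans s) (by rw [IsRotation, det_trans, hs, hσ]; norm_num) u x, sphMap_trans,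
    sphMap_trans, h1, h2]

/-! ### Zonal functions -/

/-- The restriction to the sphere of a linear functional. -/
def linFun (y : Euc n) : C(Sph n, ℝ) := ⟨fun u => inner ℝ y (u : Euc n), by fun_prop⟩

@[simp]
theorem linFun_apply (y : Euc n) (u : Sph n) : linFun y u = inner ℝ y (u : Euc n) := rfl

theorem linFun_pow_mem_polySphere (y : Euc n) (k : ℕ) : linFun y ^ k ∈ polySphere n k := by
  refine ⟨(∑ i, C (y i) * X i) ^ k, ?_, ?_⟩
  · have := (MvPolynomial.IsHomogeneous.sum Finset.univ (fun i => C (y i) * X i) 1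
      (fun i _ => MvPolynomial.isHomogeneous_C_mul_X (y i) i)).pow k
    rwa [one_mul] at this
  · ext u
    simp [restrictSphere_apply, PiLp.inner_apply, mul_comm]

theorem sphInt_mul_zonal_eq_zero (hn : 2 ≤ n) {m : ℕ} {f g : C(Sph n, ℝ)}
    (hf : f ∈ sphericalHarmonic n m) (x : Euc n) {q : Polynomial ℝ} (hq : q.degree < m)
    (hg : ∀ u : Sph n, g u = q.eval (inner ℝ x (u : Euc n))) : sphInt n (f * g) = 0 := by
  have : g = ∑ k ∈ q.support, q.coeff k • linFun x ^ k := by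
    ext u
    rw [hg, Polynomial.eval_eq_sum, Polynomial.sum_def]
    simp [ContinuousMap.sum_apply]
  rw [this, Finset.mul_sum, map_sum]
  refine Finset.sum_eq_zero fun k hk => ?_
  have hkm : k < m := by
    have := (Polynomial.le_degree_of_mem_supp k hk).trans_lt hq
    exact_mod_cast this
  exact sphInt_sphericalHarmonic_mul hn hkm hf
    (Submodule.smul_mem _ _ (linFun_pow_mem_polySphere x k))

/-- A polynomial function on the sphere that is invariant under the stabilizer of a point is a
polynomial in the inner product with this point. -/
theorem exists_eq_eval_inner (hn : 2 ≤ n) {m : ℕ} {f : C(Sph n, ℝ)} (hf : f ∈ polySphere n m)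
    (x : Sph n) (hx : ∀ e : Euc n ≃ₗᵢ[ℝ] Euc n, e x = x → pull e f = f) :
    ∃ q : Polynomial ℝ, q.natDegree ≤ m ∧
      ∀ u : Sph n, f u = q.eval (inner ℝ (x : Euc n) (u : Euc n)) := by
  obtain ⟨p, hp, rfl⟩ := hf
  obtain ⟨v, hv, hxv⟩ := exists_norm_eq_one_inner_eq_zero hn (x : Euc n)
  have hvx : inner ℝ v (x : Euc n) = 0 := by rw [real_inner_comm, hxv]
  -- The restriction of p to the plane of x and v, in the coordinates of this basis.
  let P : MvPolynomial (Fin 2) ℝ :=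
    MvPolynomial.aeval (fun i => C ((x : Euc n) i) * X 0 + C (v i) * X 1) p
  have hP : P.IsHomogeneous m := by
    have := MvPolynomial.IsHomogeneous.aeval (n := 1) hp
      (fun i => C ((x : Euc n) i) * X 0 + C (v i) * (X 1 : MvPolynomial (Fin 2) ℝ))
      (fun i => (MvPolynomial.isHomogeneous_C_mul_X _ _).add
        (MvPolynomial.isHomogeneous_C_mul_X _ _))
    rwa [one_mul] at this
  have hPe : ∀ t s : ℝ, MvPolynomial.eval ![t, s] P =
      MvPolynomial.eval (fun i => (t • (x : Euc n) + s • v) i) p := by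
    intro t s
    have : ∀ p : MvPolynomial (Fin n) ℝ, MvPolynomial.eval ![t, s] (MvPolynomial.aeval
        (fun i => C ((x : Euc n) i) * X 0 + C (v i) * (X 1 : MvPolynomial (Fin 2) ℝ)) p) =
        MvPolynomial.eval (fun i => (t • (x : Euc n) + s • v) i) p := by
      intro p
      induction p using MvPolynomial.induction_on with
      | C a => simp
      | add p q hp hq => rw [map_add, map_add, map_add, hp, hq]
      | mul_X p i hp =>
        rw [map_mul, map_mul, map_mul, hp, MvPolynomial.aeval_X]
        simp [mul_comm]
    exact this p
  -- The unit vectors u and t x + s v have the same inner product with x, so the reflection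
  -- interchanging them fixes x. Both signs of s are admissible.
  have key : ∀ (u : Sph n) (t s : ℝ), t = inner ℝ (x : Euc n) (u : Euc n) → s ^ 2 = 1 - t ^ 2 →
      restrictSphere n p u = MvPolynomial.eval ![t, s] P := by
    intro u t s ht hs
    have hnorm : ‖t • (x : Euc n) + s • v‖ = 1 := by
      rw [← sq_eq_sq₀ (norm_nonneg _) zero_le_one, ← real_inner_self_eq_norm_sq]
      simp only [inner_add_left, inner_add_right, real_inner_smul_left, real_inner_smul_right,
        hxv, hvx, real_inner_self_eq_norm_sq (x : Euc n), real_inner_self_eq_norm_sq v, hv,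
        norm_sph]
      linear_combination hs
    let e : Euc n ≃ₗᵢ[ℝ] Euc n :=
      Submodule.reflection (ℝ ∙ ((u : Euc n) - (t • (x : Euc n) + s • v)))ᗮ
    have he : e u = t • (x : Euc n) + s • v :=
      Submodule.reflection_sub (by rw [hnorm, norm_sph])
    have hex : e x = x := by
      refine Submodule.reflection_mem_subspace_eq_self ?_
      rw [Submodule.mem_orthogonal_singleton_iff_inner_left]
      simp only [inner_sub_right, inner_add_right, real_inner_smul_right, hxv,
        real_inner_self_eq_norm_sq, norm_sph, ← ht]
      ring
    rw [hPe, ← hx e hex, pull_apply, restrictSphere_apply, coe_sphMap, he]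
  -- Averaging over s and -s kills the odd powers of s, and in the even ones s² = 1 - t².
  let q : Polynomial ℝ := ∑ d ∈ P.support, if Even (d 1) then
    Polynomial.C (P.coeff d) * (Polynomial.X ^ d 0 * (1 - Polynomial.X ^ 2) ^ (d 1 / 2)) else 0
  refine ⟨q, ?_, fun u => ?_⟩
  · refine Polynomial.natDegree_sum_le_of_forall_le _ _ fun d hd => ?_
    have hdeg := hP.degree_eq_sum_deg_support hd
    have hdeg' : m = d 0 + d 1 := by
      rw [hdeg, ← Fin.sum_univ_two]
      exact (Finset.sum_subset (Finset.subset_univ _) (by simp))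
    split_ifs with hev
    · refine (Polynomial.natDegree_C_mul_le _ _).trans (Polynomial.natDegree_mul_le.trans ?_)
      have h1 : (Polynomial.X ^ d 0 : Polynomial ℝ).natDegree ≤ d 0 := by simp
      have h2 : ((1 - Polynomial.X ^ 2 : Polynomial ℝ) ^ (d 1 / 2)).natDegree ≤ d 1 / 2 * 2 := by
        refine Polynomial.natDegree_pow_le.trans (Nat.mul_le_mul_left _ ?_)
        exact (Polynomial.natDegree_sub_le _ _).trans (by simp)
      have := Nat.div_mul_le_self (d 1) 2
      omega
    · simp
  · set t := inner ℝ (x : Euc n) (u : Euc n) with ht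
    have ht1 : t ^ 2 ≤ 1 := by
      have := abs_real_inner_le_norm (x : Euc n) (u : Euc n)
      rw [norm_sph, norm_sph, one_mul, ← ht] at this
      rw [← sq_abs]
      exact pow_le_one₀ (abs_nonneg _) this
    let s := Real.sqrt (1 - t ^ 2)
    have hs : s ^ 2 = 1 - t ^ 2 := Real.sq_sqrt (by linarith)
    have h1 := key u t s ht hs
    have h2 := key u t (-s) ht (by rw [neg_sq, hs])
    have h3 : restrictSphere n p u =
        (MvPolynomial.eval ![t, s] P + MvPolynomial.eval ![t, -s] P) / 2 := by
      rw [← h1, ← h2]; ring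
    rw [h3, MvPolynomial.eval_eq', MvPolynomial.eval_eq', ← Finset.sum_add_distrib, Finset.sum_div,
      Polynomial.eval_finsetSum]
    refine Finset.sum_congr rfl fun d _ => ?_
    simp only [Fin.prod_univ_two, Matrix.cons_val_zero, Matrix.cons_val_one]
    split_ifs with hev
    · obtain ⟨j, hj⟩ := hev
      have e1 : d 1 / 2 = j := by omega
      have e2 : s ^ d 1 = (1 - t ^ 2) ^ j := by rw [hj, ← two_mul, pow_mul, hs]
      have e3 : (-s) ^ d 1 = (1 - t ^ 2) ^ j := by rw [hj, ← two_mul, pow_mul, neg_sq, hs]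
      simp [e1, e2, e3]
    · rw [Nat.not_even_iff_odd] at hev
      rw [hev.neg_pow]; simp

/-- Zonal spherical harmonics with a given axis are unique up to a factor. -/
theorem exists_eq_smul_of_zonal (hn : 2 ≤ n) {m : ℕ} {f g : C(Sph n, ℝ)}
    (hf : f ∈ sphericalHarmonic n m) (hg : g ∈ sphericalHarmonic n m) (hg0 : g ≠ 0) (x : Sph n)
    (hfx : ∀ e : Euc n ≃ₗᵢ[ℝ] Euc n, e x = x → pull e f = f)
    (hgx : ∀ e : Euc n ≃ₗᵢ[ℝ] Euc n, e x = x → pull e g = g) : ∃ c : ℝ, f = c • g := by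
  obtain ⟨q, hq, hqf⟩ := exists_eq_eval_inner hn (sphericalHarmonic_le_polySphere m hf) x hfx
  obtain ⟨r, hr, hrg⟩ := exists_eq_eval_inner hn (sphericalHarmonic_le_polySphere m hg) x hgx
  have hdeg : ∀ {q : Polynomial ℝ}, q.natDegree ≤ m → q.coeff m = 0 → q.degree < m := by
    intro q hq h0
    refine (Polynomial.degree_lt_iff_coeff_zero q m).2 fun k hk => ?_
    rcases hk.eq_or_lt with rfl | hk
    · exact h0
    · exact Polynomial.coeff_eq_zero_of_natDegree_lt (hq.trans_lt hk)
  -- Without a term of degree m, g would be orthogonal to itself. The same argument below shows that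
  -- f minus a multiple of g vanishes, once the terms of degree m cancel.
  have hrm : r.coeff m ≠ 0 := fun h0 =>
    hg0 (eq_zero_of_sphInt_mul_self (sphInt_mul_zonal_eq_zero hn hg x (hdeg hr h0) hrg))
  refine ⟨q.coeff m / r.coeff m, sub_eq_zero.1 (eq_zero_of_sphInt_mul_self ?_)⟩
  refine sphInt_mul_zonal_eq_zero hn (Submodule.sub_mem _ hf (Submodule.smul_mem _ _ hg)) x
    (q := q - Polynomial.C (q.coeff m / r.coeff m) * r) (hdeg ?_ ?_) fun u => ?_
  · exact (Polynomial.natDegree_sub_le _ _).trans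
      (max_le hq ((Polynomial.natDegree_C_mul_le _ _).trans hr))
  · simp [hrm]
  · simp [hqf, hrg]

/-! ### Irreducibility -/

/-- The reproducing kernel of a rotation invariant finite-dimensional space. -/
theorem exists_reproducing_kernel (hn : 2 ≤ n) (W : Submodule ℝ C(Sph n, ℝ))
    [FiniteDimensional ℝ W] (hW : ∀ e, IsRotation e → ∀ f ∈ W, pull e f ∈ W) :
    ∃ w : Sph n → C(Sph n, ℝ), (∀ x, w x ∈ W) ∧ (∀ x, ∀ v ∈ W, sphInt n (w x * v) = v x) ∧
      ∀ (e : Euc n ≃ₗᵢ[ℝ] Euc n) (x : Sph n), pull e (w (sphMap e x)) = w x := by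
  have hex : ∀ x : Sph n, ∃ w ∈ W, ∀ v ∈ W, sphInt n (w * v) = v x := fun x => by
    obtain ⟨w, hw, h⟩ := exists_sphInt_mul_eq W
      ((ContinuousMap.evalCLM ℝ x : C(Sph n, ℝ) →L[ℝ] ℝ).toLinearMap ∘ₗ W.subtype)
    exact ⟨w, hw, fun v hv => h ⟨v, hv⟩⟩
  choose w hwW hw using hex
  have hsymm : ∀ x y, w x y = w y x := fun x y => by
    rw [← hw y (w x) (hwW x), ← hw x (w y) (hwW y), mul_comm]
  have hrot : ∀ e, IsRotation e → ∀ x, pull e (w (sphMap e x)) = w x := by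
    intro e he x
    have hmem := hW e he _ (hwW (sphMap e x))
    -- Both functions represent evaluation at x on W, so their difference is orthogonal to itself.
    refine sub_eq_zero.1 (eq_zero_of_sphInt_mul_self ?_)
    have hv : ∀ v ∈ W, sphInt n ((pull e (w (sphMap e x)) - w x) * v) = 0 := by
      intro v hv
      rw [sub_mul, map_sub, hw x v hv, ← pull_pull_symm e v, ← pull_mul, sphInt_pull,
        hw _ _ (hW _ he.symm v hv), pull_pull_symm, pull_apply, sphMap_symm_apply, sub_self]
    exact hv _ (Submodule.sub_mem _ hmem (hwW x))
  refine ⟨w, hwW, hw, fun e x => ?_⟩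
  -- W is only assumed invariant under rotations, but the kernel is symmetric, so `kernel_swap`
  -- covers improper isometries. For n = 2 these are indispensable, as no nontrivial rotation fixes
  -- x.
  rcases det_eq_one_or e with he | he
  · exact hrot e he x
  · ext y
    rw [pull_apply, hsymm]
    exact kernel_swap hn (Φ := fun a b => w a b)
      (fun e he u x => DFunLike.congr_fun (hrot e he u) x) he x y

/-- The space of spherical harmonics of a given order is irreducible under rotations. -/
theorem eq_sphericalHarmonic_of_invariant (hn : 2 ≤ n) {m : ℕ} {W : Submodule ℝ C(Sph n, ℝ)}
    (hle : W ≤ sphericalHarmonic n m) (h0 : W ≠ ⊥)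
    (hW : ∀ e, IsRotation e → ∀ f ∈ W, pull e f ∈ W) : W = sphericalHarmonic n m := by
  have : FiniteDimensional ℝ W := Submodule.finiteDimensional_of_le hle
  obtain ⟨w, hwW, hw, hwe⟩ := exists_reproducing_kernel hn W hW
  obtain ⟨z, hzW, hz, hze⟩ := exists_reproducing_kernel hn (sphericalHarmonic n m)
    (fun e _ f hf => pull_mem_sphericalHarmonic hn e hf)
  obtain ⟨f, hf, hf0⟩ := Submodule.exists_mem_ne_zero_of_ne_bot h0
  obtain ⟨x₀, hx₀⟩ := DFunLike.ne_iff.1 hf0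
  have hw0 : w x₀ ≠ 0 := by
    intro h
    have := hw x₀ f hf
    rw [h, zero_mul, map_zero] at this
    exact hx₀ this.symm
  have hne : ∀ x, w x ≠ 0 := by
    intro x h
    obtain ⟨σ, -, h1, -⟩ := exists_reflection_swap hn x₀ x
    have := hwe σ x₀
    rw [h1, h, map_zero] at this
    exact hw0 this.symm
  -- Both kernels at x are zonal harmonics with axis x, so the kernel of the whole space is a
  -- multiple of the nonzero kernel of W.
  have hzmem : ∀ x, z x ∈ W := by
    intro x
    have hfix : ∀ e : Euc n ≃ₗᵢ[ℝ] Euc n, e x = x → sphMap e x = x := fun e he => Subtype.ext he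
    obtain ⟨c, hc⟩ := exists_eq_smul_of_zonal hn (hzW x) (hle (hwW x)) (hne x) x
      (fun e he => by conv_rhs => rw [← hze e x, hfix e he])
      (fun e he => by conv_rhs => rw [← hwe e x, hfix e he])
    rw [hc]
    exact Submodule.smul_mem _ _ (hwW x)
  refine le_antisymm hle fun v hv => ?_
  -- The difference of v and its orthogonal projection p to W is orthogonal to each z x, and so
  -- vanishes at each x.
  obtain ⟨p, hp, h⟩ := exists_sphInt_sub_mul_eq_zero W v
  have : v = p := by
    ext x
    have h1 := hz x _ (Submodule.sub_mem _ hv (hle hp))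
    rw [mul_comm, h _ (hzmem x)] at h1
    exact (sub_eq_zero.1 h1.symm)
  exact this ▸ hp

/-! ### The rotation group -/

/-- The rotation group `SO(n)`. -/
abbrev SO (n : ℕ) := Matrix.specialOrthogonalGroup (Fin n) ℝ

theorem mem_SO_iff {A : Matrix (Fin n) (Fin n) ℝ} :
    A ∈ SO n ↔ A * A.transpose = 1 ∧ A.det = 1 := by
  rw [Matrix.mem_specialOrthogonalGroup_iff, Matrix.mem_orthogonalGroup_iff]

theorem coe_inv_SO (g : SO n) :
    ((g⁻¹ : SO n) : Matrix (Fin n) (Fin n) ℝ) = (g : Matrix (Fin n) (Fin n) ℝ).transpose := by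
  have h1 := (mem_SO_iff.1 g.2).1
  have h2 : ((g⁻¹ : SO n) : Matrix (Fin n) (Fin n) ℝ) * g = 1 := by
    rw [← Submonoid.coe_mul, inv_mul_cancel, Submonoid.coe_one]
  calc ((g⁻¹ : SO n) : Matrix (Fin n) (Fin n) ℝ) = (g⁻¹ : SO n) * ((g : Matrix (Fin n) (Fin n) ℝ) *
        (g : Matrix (Fin n) (Fin n) ℝ).transpose) := by rw [h1, mul_one]
    _ = _ := by rw [← mul_assoc, h2, one_mul]

instance isTopologicalGroup_SO : IsTopologicalGroup (SO n) where
  continuous_inv := by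
    rw [continuous_induced_rng]
    have : (Subtype.val ∘ fun g : SO n => g⁻¹) =
        fun g : SO n => (g : Matrix (Fin n) (Fin n) ℝ).transpose := by
      ext1 g; exact coe_inv_SO g
    rw [this]
    exact continuous_subtype_val.matrix_transpose

instance compactSpace_SO : CompactSpace (SO n) := by
  suffices h : IsCompact ((SO n : Submonoid _) : Set (Matrix (Fin n) (Fin n) ℝ)) from
    isCompact_iff_compactSpace.1 h
  have hcl : IsClosed ((SO n : Submonoid _) : Set (Matrix (Fin n) (Fin n) ℝ)) := by
    have : ((SO n : Submonoid _) : Set (Matrix (Fin n) (Fin n) ℝ)) =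
        {A | A * A.transpose = 1} ∩ {A | A.det = 1} := by
      ext A; exact mem_SO_iff
    rw [this]
    refine IsClosed.inter (isClosed_eq ?_ continuous_const) (isClosed_eq ?_ continuous_const)
    · exact continuous_id.matrix_mul continuous_id.matrix_transpose
    · exact continuous_id.matrix_det
  have hK : IsCompact (Set.univ.pi fun _ : Fin n => Set.univ.pi fun _ : Fin n =>
      Set.Icc (-1 : ℝ) 1) :=
    isCompact_univ_pi fun _ => isCompact_univ_pi fun _ => isCompact_Icc
  refine hK.of_isClosed_subset hcl fun (A : Matrix (Fin n) (Fin n) ℝ) hA => ?_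
  have h1 : A ∈ Matrix.unitaryGroup (Fin n) ℝ := by
    rw [Matrix.mem_unitaryGroup_iff, Matrix.star_eq_conjTranspose,
      Matrix.conjTranspose_eq_transpose_of_trivial]
    exact (mem_SO_iff.1 hA).1
  intro i _ j _
  have := entry_norm_bound_of_unitary h1 i j
  rw [Real.norm_eq_abs] at this
  exact abs_le.1 this

instance measurableSpace_SO : MeasurableSpace (SO n) := borel _

instance borelSpace_SO : BorelSpace (SO n) := ⟨rfl⟩

/-- The Haar measure on the rotation group. -/
def rotMeasure (n : ℕ) : Measure (SO n) := Measure.haar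

instance : (rotMeasure n).IsHaarMeasure := inferInstanceAs (Measure.haar).IsHaarMeasure

instance : IsFiniteMeasure (rotMeasure n) :=
  CompactSpace.isFiniteMeasure

theorem rotMeasure_real_univ_ne_zero : (rotMeasure n).real univ ≠ 0 := by
  rw [measureReal_ne_zero_iff]
  exact isOpen_univ.measure_ne_zero _ univ_nonempty

/-- The linear isometry given by a rotation matrix. -/
def toIso (g : SO n) : Euc n ≃ₗᵢ[ℝ] Euc n :=
  LinearIsometry.toLinearIsometryEquiv
    { toLinearMap := (Matrix.toEuclideanCLM (n := Fin n) (𝕜 := ℝ)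
        (g : Matrix (Fin n) (Fin n) ℝ)).toLinearMap
      norm_map' := fun x => by
        have h : star (g : Matrix (Fin n) (Fin n) ℝ) * g = 1 := by
          rw [Matrix.star_eq_conjTranspose, Matrix.conjTranspose_eq_transpose_of_trivial,
            ← coe_inv_SO, ← Submonoid.coe_mul, inv_mul_cancel, Submonoid.coe_one]
        have h1 := congrArg (Matrix.toEuclideanCLM (n := Fin n) (𝕜 := ℝ)) h
        rw [map_mul, map_star, map_one, ContinuousLinearMap.star_eq_adjoint] at h1
        exact (ContinuousLinearMap.norm_map_iff_adjoint_comp_self _).2 h1 x } rfl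

theorem toIso_apply (g : SO n) (x : Euc n) :
    toIso g x = Matrix.toEuclideanCLM (n := Fin n) (𝕜 := ℝ) (g : Matrix (Fin n) (Fin n) ℝ) x := rfl

theorem toIso_mul_apply (g h : SO n) (x : Euc n) : toIso (g * h) x = toIso g (toIso h x) := by
  simp only [toIso_apply, Submonoid.coe_mul, map_mul]; rfl

theorem toIso_one_apply (x : Euc n) : toIso (1 : SO n) x = x := by
  simp only [toIso_apply, Submonoid.coe_one, map_one]; rfl

theorem toIso_symm (g : SO n) : (toIso g).symm = toIso g⁻¹ := by
  ext1 x
  rw [LinearIsometryEquiv.symm_apply_eq, ← toIso_mul_apply, mul_inv_cancel, toIso_one_apply]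

theorem sphMap_toIso_mul (g h : SO n) (u : Sph n) :
    sphMap (toIso (g * h)) u = sphMap (toIso g) (sphMap (toIso h) u) :=
  Subtype.ext (toIso_mul_apply g h u)

theorem exists_toIso_eq {e : Euc n ≃ₗᵢ[ℝ] Euc n} (he : IsRotation e) : ∃ g : SO n, toIso g = e := by
  let b := EuclideanSpace.basisFun (Fin n) ℝ
  let A := LinearMap.toMatrix b.toBasis b.toBasis (e.toLinearEquiv : Euc n →ₗ[ℝ] Euc n)
  have hA : A ∈ SO n := by
    rw [mem_SO_iff]
    constructor
    · have := e.toMatrix_mem_unitaryGroup b b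
      rwa [Matrix.mem_unitaryGroup_iff, Matrix.star_eq_conjTranspose,
        Matrix.conjTranspose_eq_transpose_of_trivial] at this
    · exact (LinearMap.det_toMatrix _ _).trans he
  refine ⟨⟨A, hA⟩, ?_⟩
  ext1 x
  have : Matrix.toLin b.toBasis b.toBasis A x = e x := by
    simp [A, Matrix.toLin_toMatrix]
  rw [← this]; rfl

/-- Joint continuity makes the orbit of a function continuous in the uniform norm, by currying. -/
theorem continuous_sphMap_toIso_inv :
    Continuous fun p : SO n × Sph n => sphMap (toIso p.1⁻¹) p.2 := by
  rw [continuous_induced_rng]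
  have : (Subtype.val ∘ fun p : SO n × Sph n => sphMap (toIso p.1⁻¹) p.2) = fun p : SO n × Sph n =>
      WithLp.toLp 2 (((p.1⁻¹ : SO n) : Matrix (Fin n) (Fin n) ℝ).mulVec
        (WithLp.ofLp (p.2 : Euc n))) := by
    ext1 p
    simp only [Function.comp_apply, coe_sphMap, toIso_apply]
    rfl
  rw [this]
  refine (PiLp.continuous_toLp 2 _).comp (Continuous.matrix_mulVec ?_ ?_)
  · exact continuous_subtype_val.comp (continuous_inv.comp continuous_fst)
  · exact (PiLp.continuous_ofLp 2 _).comp (continuous_subtype_val.comp continuous_snd)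

/-- The orbit of a function on the sphere under the rotation group. -/
def orbitMap (f : C(Sph n, ℝ)) : C(SO n, C(Sph n, ℝ)) :=
  ContinuousMap.curry ⟨fun p : SO n × Sph n => f (sphMap (toIso p.1⁻¹) p.2),
    f.continuous.comp continuous_sphMap_toIso_inv⟩

theorem orbitMap_apply (f : C(Sph n, ℝ)) (g : SO n) : orbitMap f g = pull (toIso g⁻¹) f := rfl

/-! ### Integrals in closed convex cones -/

/-- The mean of φ lies in the closed convex set S, and the integral is the mean times the total
mass. -/
theorem integral_mem_of_cone {Y E : Type*} [TopologicalSpace Y] [CompactSpace Y]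
    [MeasurableSpace Y] [OpensMeasurableSpace Y] [NormedAddCommGroup E] [NormedSpace ℝ E]
    [CompleteSpace E] (μ : Measure Y) [IsFiniteMeasure μ] {S : Set E} (hcl : IsClosed S)
    (hne : S.Nonempty) (hadd : ∀ x ∈ S, ∀ y ∈ S, x + y ∈ S)
    (hsmul : ∀ c : ℝ, 0 ≤ c → ∀ x ∈ S, c • x ∈ S) {φ : Y → E} (hφ : Continuous φ)
    (hmem : ∀ y, φ y ∈ S) : ∫ y, φ y ∂μ ∈ S := by
  by_cases hμ : μ = 0
  · obtain ⟨x, hx⟩ := hne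
    simpa [hμ] using hsmul 0 le_rfl x hx
  have : NeZero μ := ⟨hμ⟩
  rw [← measure_smul_average]
  refine hsmul _ measureReal_nonneg _ (Convex.average_mem ?_ hcl (ae_of_all _ hmem)
    (hφ.integrable_of_hasCompactSupport (HasCompactSupport.of_compactSpace _)))
  intro x hx y hy a b ha hb _
  exact hadd _ (hsmul a ha x hx) _ (hsmul b hb y hy)

theorem integral_mem_submodule {Y E : Type*} [TopologicalSpace Y] [CompactSpace Y]
    [MeasurableSpace Y] [OpensMeasurableSpace Y] [NormedAddCommGroup E] [NormedSpace ℝ E]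
    [CompleteSpace E] (μ : Measure Y) [IsFiniteMeasure μ] (W : Submodule ℝ E)
    [FiniteDimensional ℝ W] {φ : Y → E} (hφ : Continuous φ) (hmem : ∀ y, φ y ∈ W) :
    ∫ y, φ y ∂μ ∈ W :=
  integral_mem_of_cone μ W.closed_of_finiteDimensional ⟨0, W.zero_mem⟩
    (fun _ hx _ hy => W.add_mem hx hy) (fun c _ _ hx => W.smul_mem c hx) hφ hmem

/-! ### Minkowski classes -/

theorem supportFun_rotate (g : SO n) (K : ConvexBody (Euc n)) (x : Euc n) :
    supportFun (rotate g K) x = supportFun K (toIso g⁻¹ x) := by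
  have hin : ∀ y : Euc n, inner ℝ x (toIso g y) = inner ℝ (toIso g⁻¹ x) y := fun y => by
    rw [← toIso_symm, ← LinearIsometryEquiv.inner_map_map (toIso g) ((toIso g).symm x),
      LinearIsometryEquiv.apply_symm_apply]
  obtain ⟨y, hy, e⟩ := exists_supportFun_eq K (toIso g⁻¹ x)
  have hm : toIso g y ∈ rotate g K := ⟨y, hy, rfl⟩
  rw [e, supportFun_eq hm, hin]
  rintro _ ⟨z, hz, rfl⟩
  rw [hin, ← e]
  exact (hin z).trans_le (inner_le_supportFun K _ hz)

theorem sphereSupport_rotate (g : SO n) (K : ConvexBody (Euc n)) :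
    sphereSupport (rotate g K) = pull (toIso g⁻¹) (sphereSupport K) := by
  ext u; exact supportFun_rotate g K u

variable {M : Set (ConvexBody (Euc n))}

/-- The differences of support functions of the bodies of a Minkowski class. -/
def differenceSpace (hM : IsMinkowskiClass M) (hne : M.Nonempty) : Submodule ℝ C(Sph n, ℝ) where
  carrier := {f | ∃ S ∈ M, ∃ T ∈ M, f = sphereSupport S - sphereSupport T}
  add_mem' := by
    rintro _ _ ⟨S, hS, T, hT, rfl⟩ ⟨S', hS', T', hT', rfl⟩
    refine ⟨_, hM.add_mem S hS S' hS', _, hM.add_mem T hT T' hT', ?_⟩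
    rw [sphereSupport_add, sphereSupport_add]; abel
  zero_mem' := hne.imp fun S hS => ⟨hS, S, hS, (sub_self _).symm⟩
  smul_mem' := by
    rintro c _ ⟨S, hS, T, hT, rfl⟩
    rcases le_total 0 c with hc | hc
    · refine ⟨_, hM.smul_mem c hc S hS, _, hM.smul_mem c hc T hT, ?_⟩
      rw [sphereSupport_smul _ hc, sphereSupport_smul _ hc, smul_sub]
    · have hc' : 0 ≤ -c := by linarith
      refine ⟨_, hM.smul_mem (-c) hc' T hT, _, hM.smul_mem (-c) hc' S hS, ?_⟩
      rw [sphereSupport_smul _ hc', sphereSupport_smul _ hc']; module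

/-- Minkowski addition turns into addition of functions, where subtraction is possible. -/
theorem mem_generalizedBodies_iff (hM : IsMinkowskiClass M) (hne : M.Nonempty)
    (L : ConvexBody (Euc n)) :
    L ∈ generalizedBodies M ↔ sphereSupport L ∈ differenceSpace hM hne := by
  constructor
  · rintro ⟨S, hS, T, hT, h⟩
    refine ⟨T, hT, S, hS, ?_⟩
    rw [← h, sphereSupport_add, add_sub_cancel_right]
  · rintro ⟨T, hT, S, hS, h⟩
    refine ⟨S, hS, T, hT, sphereSupport_injective ?_⟩
    rw [sphereSupport_add, h, sub_add_cancel]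

theorem pull_mem_differenceSpace (hM : IsMinkowskiClass M) (hne : M.Nonempty)
    (hr : IsRotationInvariant M) {e : Euc n ≃ₗᵢ[ℝ] Euc n} (he : IsRotation e) {f : C(Sph n, ℝ)}
    (hf : f ∈ differenceSpace hM hne) : pull e f ∈ differenceSpace hM hne := by
  obtain ⟨S, hS, T, hT, rfl⟩ := hf
  obtain ⟨g, rfl⟩ := exists_toIso_eq he
  refine ⟨_, hr g⁻¹ S hS, _, hr g⁻¹ T hT, ?_⟩
  rw [sphereSupport_rotate, sphereSupport_rotate, inv_inv, map_sub]

/-- Integrals of rotated bodies of a rotation invariant Minkowski class belong to the class. -/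
theorem integral_smul_orbitMap_mem [Nonempty (Sph n)] (hM : IsMinkowskiClass M)
    (hr : IsRotationInvariant M) {K : ConvexBody (Euc n)} (hK : K ∈ M) {c : SO n → ℝ}
    (hc : Continuous c) (hc0 : ∀ g, 0 ≤ c g) :
    ∫ g, c g • orbitMap (sphereSupport K) g ∂(rotMeasure n) ∈ sphereSupport '' M := by
  refine integral_mem_of_cone _ (isClosedEmbedding_sphereSupport.isClosedMap _ hM.isClosed)
    ⟨_, K, hK, rfl⟩ ?_ ?_ (hc.smul (orbitMap _).continuous) fun g => ?_
  · rintro _ ⟨S, hS, rfl⟩ _ ⟨T, hT, rfl⟩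
    exact ⟨_, hM.add_mem S hS T hT, sphereSupport_add S T⟩
  · rintro c hc _ ⟨S, hS, rfl⟩
    exact ⟨_, hM.smul_mem c hc S hS, sphereSupport_smul S hc⟩
  · refine ⟨_, hM.smul_mem (c g) (hc0 g) _ (hr g K hK), ?_⟩
    rw [sphereSupport_smul _ (hc0 g), sphereSupport_rotate, orbitMap_apply]

theorem integrable_SO {E : Type*} [NormedAddCommGroup E] {φ : SO n → E} (hφ : Continuous φ) :
    Integrable φ (rotMeasure n) :=
  hφ.integrable_of_hasCompactSupport (HasCompactSupport.of_compactSpace _)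

theorem integral_smul_orbitMap_apply {c : SO n → ℝ} (hc : Continuous c) (f : C(Sph n, ℝ))
    (u : Sph n) : (∫ g, c g • orbitMap f g ∂(rotMeasure n)) u =
      ∫ g, c g * f (sphMap (toIso g⁻¹) u) ∂(rotMeasure n) :=
  ((ContinuousMap.evalCLM ℝ u : C(Sph n, ℝ) →L[ℝ] ℝ).integral_comp_comm
    (integrable_SO (hc.smul (orbitMap f).continuous))).symm

theorem continuous_orbit_apply (f : C(Sph n, ℝ)) (u : Sph n) :
    Continuous fun g : SO n => f (sphMap (toIso g⁻¹) u) :=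
  (continuous_eval_const u).comp (orbitMap f).continuous

/-- If the support function of some body in the class has a nonzero harmonic component of order
`m`, then all spherical harmonics of order `m` are differences of support functions of bodies in
the class. -/
theorem sphericalHarmonic_le_differenceSpace (hn : 2 ≤ n) (hM : IsMinkowskiClass M)
    (hne : M.Nonempty) (hr : IsRotationInvariant M) {K : ConvexBody (Euc n)} (hK : K ∈ M) {m : ℕ}
    (hm : harmonicProj n m (sphereSupport K) ≠ 0) :
    sphericalHarmonic n m ≤ differenceSpace hM hne := by
  have := nonempty_sph hn
  set h := sphereSupport K with hh
  obtain ⟨q, hq, hqh⟩ : ∃ q ∈ sphericalHarmonic n m, sphInt n (h * q) ≠ 0 := by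
    by_contra! hc
    exact hm (harmonicProj_eq_zero_iff.2 hc)
  let Φ : Sph n → Sph n → ℝ := fun u x =>
    ∫ g, h (sphMap (toIso g⁻¹) u) * q (sphMap (toIso g⁻¹) x) ∂(rotMeasure n)
  have hΦ : ∀ e, IsRotation e → ∀ u x, Φ (sphMap e u) (sphMap e x) = Φ u x := by
    intro e he u x
    obtain ⟨r, rfl⟩ := exists_toIso_eq he
    -- Substituting r g for g in the Haar integral cancels r in both arguments.
    have := integral_mul_left_eq_self (μ := rotMeasure n) (fun g => h (sphMap (toIso g⁻¹)
      (sphMap (toIso r) u)) * q (sphMap (toIso g⁻¹) (sphMap (toIso r) x))) r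
    simp only [mul_inv_rev, ← sphMap_toIso_mul, inv_mul_cancel_right] at this
    simp only [Φ, ← sphMap_toIso_mul]
    exact this.symm
  -- A and B read the same kernel Φ in its two variables: A x averages rotations of h, and B u
  -- averages rotations of q.
  let A : Sph n → C(Sph n, ℝ) := fun x =>
    ∫ g, q (sphMap (toIso g⁻¹) x) • orbitMap h g ∂(rotMeasure n)
  let B : Sph n → C(Sph n, ℝ) := fun u =>
    ∫ g, h (sphMap (toIso g⁻¹) u) • orbitMap q g ∂(rotMeasure n)
  have hA : ∀ u x, A x u = Φ u x := fun u x => by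
    refine (integral_smul_orbitMap_apply (continuous_orbit_apply q x) h u).trans ?_
    exact integral_congr_ae (ae_of_all _ fun g => mul_comm _ _)
  have hB : ∀ u x, B u x = Φ u x := fun u x =>
    integral_smul_orbitMap_apply (continuous_orbit_apply h u) q x
  have hBmem : ∀ u, B u ∈ sphericalHarmonic n m := fun u =>
    integral_mem_submodule _ _ ((continuous_orbit_apply h u).smul (orbitMap q).continuous)
      fun g => Submodule.smul_mem _ _ (orbitMap_apply q g ▸ pull_mem_sphericalHarmonic hn _ hq)
  -- Only nonnegative weights keep the average in the cone of M, so the weight is split into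
  -- positive and negative parts.
  have hAD : ∀ x, A x ∈ differenceSpace hM hne := by
    intro x
    have hc := continuous_orbit_apply q x
    have hc1 : Continuous fun g : SO n => max (q (sphMap (toIso g⁻¹) x)) 0 :=
      hc.max continuous_const
    have hc2 : Continuous fun g : SO n => max (-q (sphMap (toIso g⁻¹) x)) 0 :=
      hc.neg.max continuous_const
    obtain ⟨S, hS, hS'⟩ := integral_smul_orbitMap_mem hM hr hK hc1 fun g => le_max_right _ _
    obtain ⟨T, hT, hT'⟩ := integral_smul_orbitMap_mem hM hr hK hc2 fun g => le_max_right _ _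
    refine ⟨S, hS, T, hT, ?_⟩
    rw [hS', hT']
    refine Eq.trans (integral_congr_ae (ae_of_all _ fun g => ?_))
      (integral_sub (integrable_SO (hc1.smul (orbitMap _).continuous))
        (integrable_SO (hc2.smul (orbitMap _).continuous)))
    simp only [← sub_smul]
    congr 1
    rcases le_total 0 (q (sphMap (toIso g⁻¹) x)) with h0 | h0
    · rw [max_eq_left h0, max_eq_right (by linarith), sub_zero]
    · rw [max_eq_right h0, max_eq_left (by linarith), zero_sub, neg_neg]
  obtain ⟨u₀⟩ := id this
  -- Any improper isometry s interchanges the roles of A and B by `kernel_swap`.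
  obtain ⟨s, hs, -⟩ := exists_reflection_swap hn u₀ u₀
  have hAH : ∀ x, A x ∈ sphericalHarmonic n m := by
    intro x
    have : A x = pull s (B (sphMap s x)) := by
      ext u
      rw [hA, pull_apply, hB, kernel_swap hn hΦ hs]
    rw [this]
    exact pull_mem_sphericalHarmonic hn _ (hBmem _)
  have hA0 : ∃ x, A x ≠ 0 := by
    by_contra! h0
    -- If all A x vanished, so would Φ(u, u) for every u. Integrating over u gives the total Haar
    -- mass times (h, q), a contradiction.
    have hdiag : ∫ g, orbitMap (h * q) g ∂(rotMeasure n) = 0 := by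
      ext u
      have h1 := hA u u
      rw [h0 u] at h1
      have h2 := integral_smul_orbitMap_apply (c := fun _ => (1 : ℝ)) continuous_const (h * q) u
      simp only [one_smul, one_mul] at h2
      rw [h2]
      exact h1.symm
    have h3 := (sphInt n).integral_comp_comm (integrable_SO (orbitMap (h * q)).continuous)
    rw [hdiag, map_zero] at h3
    simp only [orbitMap_apply, sphInt_pull, integral_const, smul_eq_mul] at h3
    exact mul_ne_zero rotMeasure_real_univ_ne_zero hqh h3
  obtain ⟨x, hx⟩ := hA0
  have hW := eq_sphericalHarmonic_of_invariant hn
    (W := differenceSpace hM hne ⊓ sphericalHarmonic n m) inf_le_right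
    (fun hbot => hx ((Submodule.mem_bot ℝ).1 (hbot ▸ ⟨hAD x, hAH x⟩)))
    (fun e he f hf => ⟨pull_mem_differenceSpace hM hne hr he hf.1,
      pull_mem_sphericalHarmonic hn e hf.2⟩)
  exact inf_eq_right.1 hW

/-! ### Smoothing by zonal polynomial kernels -/

theorem continuous_linFun_coe : Continuous fun v : Sph n => linFun (v : Euc n) :=
  (ContinuousMap.curry (⟨fun p : Sph n × Sph n => inner ℝ (p.1 : Euc n) (p.2 : Euc n),
    by fun_prop⟩ : C(Sph n × Sph n, ℝ))).continuous

theorem integrable_of_continuous {E : Type*} [NormedAddCommGroup E] {φ : Sph n → E}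
    (hφ : Continuous φ) : Integrable φ (sphereMeasure n) :=
  hφ.integrable_of_hasCompactSupport (HasCompactSupport.of_compactSpace _)

/-- The convolution of a function on the sphere with the kernel `(1 + ⟨u, v⟩) ^ k`. -/
def smoothing (k : ℕ) (f : C(Sph n, ℝ)) : C(Sph n, ℝ) :=
  ∫ v, f v • (1 + linFun (v : Euc n)) ^ k ∂(sphereMeasure n)

theorem smoothing_apply (k : ℕ) (f : C(Sph n, ℝ)) (u : Sph n) :
    smoothing k f u = ∫ v, f v * (1 + inner ℝ (v : Euc n) (u : Euc n)) ^ k ∂(sphereMeasure n) := by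
  have hc : Continuous fun v : Sph n => f v • (1 + linFun (v : Euc n)) ^ k :=
    f.continuous.smul ((continuous_const.add continuous_linFun_coe).pow k)
  exact ((ContinuousMap.evalCLM ℝ u : C(Sph n, ℝ) →L[ℝ] ℝ).integral_comp_comm
    (integrable_of_continuous hc)).symm

/-- The vector-valued moment `∫ f(v) ⟨v, ·⟩ ^ j dσ(v)`. -/
def moment (j : ℕ) (f : C(Sph n, ℝ)) : C(Sph n, ℝ) :=
  ∫ v, f v • linFun (v : Euc n) ^ j ∂(sphereMeasure n)

theorem continuous_moment_integrand (j : ℕ) (f : C(Sph n, ℝ)) :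
    Continuous fun v : Sph n => f v • linFun (v : Euc n) ^ j :=
  f.continuous.smul (continuous_linFun_coe.pow j)

theorem moment_mem_polySphere (j : ℕ) (f : C(Sph n, ℝ)) : moment j f ∈ polySphere n j :=
  integral_mem_submodule _ _ (continuous_moment_integrand j f)
    fun _ => Submodule.smul_mem _ _ (linFun_pow_mem_polySphere _ j)

/-- The antipodal map fixes f and changes the sign of an odd power of ⟨u, ·⟩. -/
theorem moment_eq_zero_of_odd {j : ℕ} (hj : Odd j) {f : C(Sph n, ℝ)}
    (hf : pull (LinearIsometryEquiv.neg ℝ) f = f) : moment j f = 0 := by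
  ext u
  have h1 : moment j f u = sphInt n (f * linFun (u : Euc n) ^ j) := by
    refine ((ContinuousMap.evalCLM ℝ u : C(Sph n, ℝ) →L[ℝ] ℝ).integral_comp_comm
      (integrable_of_continuous (continuous_moment_integrand j f))).symm.trans ?_
    refine integral_congr_ae (ae_of_all _ fun v => ?_)
    simp [real_inner_comm]
  have h2 : pull (LinearIsometryEquiv.neg ℝ) (linFun (u : Euc n) ^ j) =
      -(linFun (u : Euc n) ^ j) := by
    ext v; simp [hj.neg_pow]
  have h3 := sphInt_pull (LinearIsometryEquiv.neg ℝ) (f * linFun (u : Euc n) ^ j)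
  rw [pull_mul, hf, h2, mul_neg, map_neg] at h3
  rw [h1, ContinuousMap.zero_apply]
  linarith

theorem smoothing_eq_sum (k : ℕ) (f : C(Sph n, ℝ)) :
    smoothing k f = ∑ j ∈ Finset.range (k + 1), (k.choose j : ℝ) • moment j f := by
  simp only [smoothing, moment, ← integral_smul]
  rw [← integral_finsetSum]
  · refine integral_congr_ae (ae_of_all _ fun v => ?_)
    simp only
    rw [add_comm, add_pow, Finset.smul_sum]
    refine Finset.sum_congr rfl fun j _ => ?_
    ext u
    simp
    ring
  · exact fun j _ => (integrable_of_continuous (continuous_moment_integrand j f)).fun_smul _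

/-- The kernel is a polynomial, so the smoothed function is a finite sum of homogeneous polynomials
and lies in D itself; D need not be closed. -/
theorem smoothing_mem_of_forall (hn : 2 ≤ n) {D : Submodule ℝ C(Sph n, ℝ)}
    (hD : ∀ m, sphericalHarmonic n m ≤ D) (k : ℕ) (f : C(Sph n, ℝ)) : smoothing k f ∈ D := by
  rw [smoothing_eq_sum]
  exact Submodule.sum_mem _ fun j _ => Submodule.smul_mem _ _
    (polySphere_le_of_forall hn j (fun i _ => hD i) (moment_mem_polySphere j f))

theorem smoothing_mem_of_forall_even (hn : 2 ≤ n) {D : Submodule ℝ C(Sph n, ℝ)}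
    (hD : ∀ m, Even m → sphericalHarmonic n m ≤ D) (k : ℕ) {f : C(Sph n, ℝ)}
    (hf : pull (LinearIsometryEquiv.neg ℝ) f = f) : smoothing k f ∈ D := by
  rw [smoothing_eq_sum]
  refine Submodule.sum_mem _ fun j _ => Submodule.smul_mem _ _ ?_
  rcases Nat.even_or_odd j with hj | hj
  · refine polySphere_le_of_forall hn j (fun i hi => hD i ?_) (moment_mem_polySphere j f)
    rw [Nat.even_iff] at hj ⊢
    omega
  · rw [moment_eq_zero_of_odd hj hf]
    exact Submodule.zero_mem _

/-! ### Smoothing preserves support functions -/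

section Sublinear

variable (K : ConvexBody (Euc n))

/-- The left side is an even convex function of t, hence nondecreasing for t ≥ 0; a and b write z ±
t d as convex combinations of z ± T d. -/
theorem supportFun_add_smul_add_sub_smul_le (z d : Euc n) {t T : ℝ} (ht : 0 ≤ t) (htT : t ≤ T) :
    supportFun K (z + t • d) + supportFun K (z - t • d) ≤
      supportFun K (z + T • d) + supportFun K (z - T • d) := by
  rcases (ht.trans htT).eq_or_lt with h0 | hT
  · have : t = 0 := by linarith
    subst this; subst h0; rfl
  set a := (T + t) / (2 * T) with ha
  set b := (T - t) / (2 * T) with hb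
  have ha0 : 0 ≤ a := by positivity
  have hb0 : 0 ≤ b := div_nonneg (by linarith) (by linarith)
  have hab : a + b = 1 := by rw [ha, hb]; field_simp; ring
  have hab' : (a - b) * T = t := by rw [ha, hb]; field_simp; ring
  have e1 : z + t • d = a • (z + T • d) + b • (z - T • d) := by
    rw [← hab']
    nth_rewrite 1 [← one_smul ℝ z]
    rw [← hab]; module
  have e2 : z - t • d = b • (z + T • d) + a • (z - T • d) := by
    rw [← hab']
    nth_rewrite 1 [← one_smul ℝ z]
    rw [← hab]; module
  have h1 := supportFun_add_le K (a • (z + T • d)) (b • (z - T • d))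
  have h2 := supportFun_add_le K (b • (z + T • d)) (a • (z - T • d))
  rw [supportFun_smul K ha0, supportFun_smul K hb0] at h1 h2
  rw [← e1] at h1
  rw [← e2] at h2
  have hb1 : b = 1 - a := by linarith
  rw [hb1] at h1 h2
  linarith

variable (e f : Euc n)

/-- The component of `x` in the plane spanned by the orthonormal vectors `e, f`. -/
def planePart (x : Euc n) : Euc n := (inner ℝ e x : ℝ) • e + (inner ℝ f x : ℝ) • f

/-- The complex product, in the plane spanned by `e, f`, of the components of `y` and `x`. -/
def planeMul (y x : Euc n) : Euc n :=
  ((inner ℝ e x : ℝ) * inner ℝ e y - (inner ℝ f x : ℝ) * inner ℝ f y) • e +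
    ((inner ℝ f x : ℝ) * inner ℝ e y + (inner ℝ e x : ℝ) * inner ℝ f y) • f

theorem planePart_add (x y : Euc n) :
    planePart e f (x + y) = planePart e f x + planePart e f y := by
  simp only [planePart, inner_add_right]; module

theorem planePart_smul (c : ℝ) (x : Euc n) : planePart e f (c • x) = c • planePart e f x := by
  simp only [planePart, real_inner_smul_right]; module

theorem planeMul_add (y x x' : Euc n) :
    planeMul e f y (x + x') = planeMul e f y x + planeMul e f y x' := by
  simp only [planeMul, inner_add_right]; module

theorem planeMul_smul (c : ℝ) (y x : Euc n) :
    planeMul e f y (c • x) = c • planeMul e f y x := by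
  simp only [planeMul, real_inner_smul_right]; module

/-- The sublinear function of `x` whose mean over `y` is the smoothed support function. -/
def planeSupport (y x : Euc n) : ℝ :=
  supportFun K (planeMul e f y x + ‖planePart e f x‖ • (y - planePart e f y)) +
    supportFun K (planeMul e f y x - ‖planePart e f x‖ • (y - planePart e f y))

theorem planeSupport_smul (y x : Euc n) {c : ℝ} (hc : 0 ≤ c) :
    planeSupport K e f y (c • x) = c * planeSupport K e f y x := by
  simp only [planeSupport, planeMul_smul, planePart_smul, norm_smul, Real.norm_of_nonneg hc,
    mul_smul, ← smul_add, ← smul_sub, supportFun_smul K hc, mul_add]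

/-- The norm of the plane part is only subadditive; the monotonicity just proved allows it to be
replaced by the sum of the two norms, after which h_K is subadditive termwise. -/
theorem planeSupport_add_le (y x x' : Euc n) :
    planeSupport K e f y (x + x') ≤ planeSupport K e f y x + planeSupport K e f y x' := by
  simp only [planeSupport, planeMul_add, planePart_add]
  set z := planeMul e f y x
  set z' := planeMul e f y x'
  set d := y - planePart e f y
  refine (supportFun_add_smul_add_sub_smul_le K (z + z') d (norm_nonneg _)
    (norm_add_le (planePart e f x) (planePart e f x'))).trans ?_
  have h1 := supportFun_add_le K (z + ‖planePart e f x‖ • d) (z' + ‖planePart e f x'‖ • d)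
  have h2 := supportFun_add_le K (z - ‖planePart e f x‖ • d) (z' - ‖planePart e f x'‖ • d)
  have e1 : z + ‖planePart e f x‖ • d + (z' + ‖planePart e f x'‖ • d) =
    z + z' + (‖planePart e f x‖ + ‖planePart e f x'‖) • d := by module
  have e2 : z - ‖planePart e f x‖ • d + (z' - ‖planePart e f x'‖ • d) =
    z + z' - (‖planePart e f x‖ + ‖planePart e f x'‖) • d := by module
  rw [e1] at h1
  rw [e2] at h2
  linarith

theorem continuous_planeSupport (x : Euc n) : Continuous fun y => planeSupport K e f y x := by
  have h := continuous_supportFun K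
  have h1 : Continuous fun y => planeMul e f y x := by unfold planeMul; fun_prop
  have h2 : Continuous fun y => planePart e f y := by unfold planePart; fun_prop
  unfold planeSupport
  fun_prop

variable {e f}

/-- For a unit vector x in the plane of e and f, rotate the integration variable by the plane
rotation R taking e to x. The kernel then no longer depends on x, and R y is the plane product of y
and x plus the unmoved orthogonal part of y. Adding the integral with that part negated makes the
integrand sublinear in x. -/
theorem two_mul_smoothing_sphereSupport (he : ‖e‖ = 1) (hf : ‖f‖ = 1) (hef : inner ℝ e f = 0)
    (k : ℕ) {x : Sph n} (hx : planePart e f x = x) :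
    2 * smoothing k (sphereSupport K) x =
      ∫ y, planeSupport K e f y x * (1 + inner ℝ e (y : Euc n)) ^ k ∂(sphereMeasure n) := by
  have hfe : inner ℝ f e = 0 := by rw [real_inner_comm]; exact hef
  let g : C(Sph n, ℝ) := sphereSupport K * (1 + linFun (x : Euc n)) ^ k
  have hg : smoothing k (sphereSupport K) x = sphInt n g := by
    rw [smoothing_apply, sphInt_apply]
    refine integral_congr_ae (ae_of_all _ fun v => ?_)
    simp [g, real_inner_comm]
  set s := inner ℝ e (x : Euc n) with hs
  set t := inner ℝ f (x : Euc n) with ht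
  have hst : s ^ 2 + t ^ 2 = 1 := by
    have h1 : ‖planePart e f x‖ ^ 2 = 1 := by rw [hx, norm_sph, one_pow]
    rw [← real_inner_self_eq_norm_sq] at h1
    simp only [planePart, inner_add_left, inner_add_right, real_inner_smul_left,
      real_inner_smul_right, hef, hfe, real_inner_self_eq_norm_sq e, real_inner_self_eq_norm_sq f,
      he, hf] at h1
    linear_combination h1
  let R := planeRotation e f he hf hef s t hst
  -- The half turn of the plane followed by -1: the identity on the plane and -1 on its orthogonal
  -- complement.
  let τ := (planeRotation e f he hf hef (-1) 0 (by norm_num)).trans (LinearIsometryEquiv.neg ℝ)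
  have hR : ∀ y, R y = planeMul e f y x + (y - planePart e f y) := fun y => by
    simp only [R, planeRotation_apply, planeMul, planePart, ← hs, ← ht]; module
  have hτ : ∀ y, τ y = planePart e f y - (y - planePart e f y) := fun y => by
    simp only [τ, LinearIsometryEquiv.trans_apply, LinearIsometryEquiv.coe_neg,
      planeRotation_apply, planePart]
    module
  have heP : ∀ y, inner ℝ e (planePart e f y) = inner ℝ e y := fun y => by
    simp only [planePart, inner_add_right, real_inner_smul_right, hef,
      real_inner_self_eq_norm_sq, he]
    ring
  have hfP : ∀ y, inner ℝ f (planePart e f y) = inner ℝ f y := fun y => by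
    simp only [planePart, inner_add_right, real_inner_smul_right, hfe,
      real_inner_self_eq_norm_sq, hf]
    ring
  have heτ : ∀ y, inner ℝ e (τ y) = inner ℝ e y := fun y => by
    rw [hτ, inner_sub_right, inner_sub_right, heP]; ring
  have hfτ : ∀ y, inner ℝ f (τ y) = inner ℝ f y := fun y => by
    rw [hτ, inner_sub_right, inner_sub_right, hfP]; ring
  have hPτ : ∀ y, planePart e f (τ y) = planePart e f y := fun y => by
    simp only [planePart, heτ, hfτ]
  have hRτ : ∀ y, R (τ y) = planeMul e f y x - (y - planePart e f y) := fun y => by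
    rw [hR, hPτ, hτ]
    have : planeMul e f (planePart e f y - (y - planePart e f y)) x = planeMul e f y x := by
      rw [← hτ]; simp only [planeMul, heτ, hfτ]
    rw [this]; abel
  have hRe : R e = x := by
    rw [hR, ← hx]
    simp only [planeMul, planePart, real_inner_self_eq_norm_sq, he, hf, hfe, hef, ← hs, ← ht,
      inner_add_right, real_inner_smul_right]
    module
  have hin : ∀ y, inner ℝ (x : Euc n) (R y) = inner ℝ e y := fun y => by
    rw [← hRe, LinearIsometryEquiv.inner_map_map]
  have h1 := sphInt_pull R g
  have h2 := sphInt_pull (τ.trans R) g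
  have h3 : 2 * sphInt n g = sphInt n (pull R g) + sphInt n (pull (τ.trans R) g) := by
    rw [h1, h2]; ring
  rw [hg, h3, ← map_add, sphInt_apply]
  refine integral_congr_ae (ae_of_all _ fun y => ?_)
  simp only [g, ContinuousMap.add_apply, pull_apply, ContinuousMap.mul_apply,
    ContinuousMap.pow_apply, ContinuousMap.one_apply, linFun_apply, coe_sphMap,
    sphereSupport_apply, LinearIsometryEquiv.trans_apply, hin, heτ, planeSupport, hx, norm_sph,
    one_smul]
  rw [hRτ, hR]
  ring

/-- Subadditivity involves only the plane of u and v. On it the smoothed function is, up to the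
factor 2, an integral of sublinear functions with a nonnegative weight. -/
theorem smoothing_sphereSupport_mem (hn : 2 ≤ n) (k : ℕ) :
    smoothing k (sphereSupport K) ∈ sublinearFunctions n := by
  intro u v w a b c ha hb hc h
  obtain ⟨f, hf, huf, hv⟩ : ∃ f : Euc n, ‖f‖ = 1 ∧ inner ℝ (u : Euc n) f = 0 ∧
      planePart (u : Euc n) f v = v := by
    have huu : inner ℝ (u : Euc n) (u : Euc n) = 1 := by
      rw [real_inner_self_eq_norm_sq, norm_sph, one_pow]
    set d : Euc n := (v : Euc n) - (inner ℝ (u : Euc n) (v : Euc n) : ℝ) • (u : Euc n) with hd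
    have hud : inner ℝ (u : Euc n) d = 0 := by
      rw [hd, inner_sub_right, real_inner_smul_right, huu]; ring
    have hvd : (v : Euc n) = (inner ℝ (u : Euc n) (v : Euc n) : ℝ) • (u : Euc n) + d := by
      rw [hd]; abel
    -- Gram–Schmidt; if v is a multiple of u, any unit vector orthogonal to u will do.
    by_cases h0 : d = 0
    · obtain ⟨f, hf, huf⟩ := exists_norm_eq_one_inner_eq_zero hn (u : Euc n)
      refine ⟨f, hf, huf, ?_⟩
      have hfu : inner ℝ f (u : Euc n) = 0 := by rw [real_inner_comm, huf]
      rw [h0, add_zero] at hvd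
      rw [planePart, ← hvd, hvd, real_inner_smul_right, hfu]
      simp
    · have hd0 : ‖d‖ ≠ 0 := norm_ne_zero_iff.2 h0
      have hdu : inner ℝ d (u : Euc n) = 0 := by rw [real_inner_comm, hud]
      refine ⟨‖d‖⁻¹ • d, by simp [norm_smul, hd0], by rw [real_inner_smul_right, hud, mul_zero], ?_⟩
      have h1 : inner ℝ (‖d‖⁻¹ • d) (v : Euc n) = ‖d‖ := by
        rw [hvd, inner_add_right, real_inner_smul_right, real_inner_smul_left, real_inner_smul_left,
          hdu, real_inner_self_eq_norm_sq]
        field_simp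
        ring
      rw [planePart, h1, smul_smul, mul_inv_cancel₀ hd0, one_smul, ← hvd]
  have hu : planePart (u : Euc n) f u = u := by
    rw [planePart, real_inner_self_eq_norm_sq, norm_sph, real_inner_comm, huf]; simp
  let G : Euc n → ℝ := fun x =>
    ∫ y, planeSupport K (u : Euc n) f y x * (1 + inner ℝ (u : Euc n) (y : Euc n)) ^ k
      ∂(sphereMeasure n)
  have hint : ∀ x, Integrable (fun y : Sph n => planeSupport K (u : Euc n) f y x *
      (1 + inner ℝ (u : Euc n) (y : Euc n)) ^ k) (sphereMeasure n) := fun x =>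
    integrable_of_continuous (((continuous_planeSupport K _ _ x).comp continuous_subtype_val).mul
      (by fun_prop))
  have hG : ∀ {x : Sph n}, planePart (u : Euc n) f x = x →
      2 * smoothing k (sphereSupport K) x = G x := fun hx =>
    two_mul_smoothing_sphereSupport K (norm_sph u) hf huf k hx
  have hGs : ∀ {c : ℝ}, 0 ≤ c → ∀ x, G (c • x) = c * G x := by
    intro c hc x
    simp only [G, planeSupport_smul K _ _ _ x hc, mul_assoc, integral_const_mul]
  have hGa : ∀ x x', G (x + x') ≤ G x + G x' := by
    intro x x'
    simp only [G]
    rw [← integral_add (hint x) (hint x')]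
    refine integral_mono (hint _) ((hint x).add (hint x')) fun y => ?_
    simp only [← add_mul]
    refine mul_le_mul_of_nonneg_right (planeSupport_add_le K _ _ _ _ _) (pow_nonneg ?_ _)
    have := neg_le_of_abs_le (abs_real_inner_le_norm (u : Euc n) (y : Euc n))
    rw [norm_sph, norm_sph] at this
    linarith
  have hkey : 2 * (c * smoothing k (sphereSupport K) w) = G (c • (w : Euc n)) := by
    -- For c = 0 the vector w may lie outside the plane, but then both sides vanish.
    rcases hc.eq_or_lt with rfl | hc
    · have := hGs le_rfl (0 : Euc n)
      rw [zero_smul, zero_mul] at this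
      rw [zero_smul, this]; ring
    · have hw : planePart (u : Euc n) f w = w := by
        have h1 := congrArg (planePart (u : Euc n) f) h
        rw [planePart_add, planePart_smul, planePart_smul, planePart_smul, hu, hv, ← h] at h1
        exact smul_right_injective _ hc.ne' h1
      rw [hGs hc.le, ← hG hw]; ring
  have h1 := hGa (a • (u : Euc n)) (b • (v : Euc n))
  rw [← h, hGs ha, hGs hb, ← hG hu, ← hG hv, ← hkey] at h1
  linarith

end Sublinear

/-! ### Approximation -/

theorem supportFun_sub_le (K : ConvexBody (Euc n)) {r : ℝ} (hr : ∀ y ∈ K, ‖y‖ ≤ r) (x z : Euc n) :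
    supportFun K x - supportFun K z ≤ r * ‖x - z‖ := by
  have h1 := supportFun_add_le K (x - z) z
  rw [sub_add_cancel] at h1
  have h2 : supportFun K (x - z) ≤ r * ‖x - z‖ := supportFun_le fun y hy => by
    rw [mul_comm]
    exact (real_inner_le_norm _ _).trans
      (mul_le_mul_of_nonneg_left (hr y hy) (norm_nonneg _))
  linarith

/-- An isometry carries u' to u. Hence the constants c k and d k below do not depend on the base
point, and the error estimate is uniform. -/
theorem integral_zonal_eq (hn : 2 ≤ n) {F : Euc n → Euc n → ℝ}
    (hF : Continuous fun p : Euc n × Euc n => F p.1 p.2)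
    (hinv : ∀ (e : Euc n ≃ₗᵢ[ℝ] Euc n) x y, F (e x) (e y) = F x y) (u u' : Sph n) :
    ∫ v, F (v : Euc n) (u : Euc n) ∂(sphereMeasure n) =
      ∫ v, F (v : Euc n) (u' : Euc n) ∂(sphereMeasure n) := by
  obtain ⟨σ, -, -, h⟩ := exists_reflection_swap hn u u'
  let g : C(Sph n, ℝ) := ⟨fun v => F (v : Euc n) (u : Euc n), by fun_prop⟩
  have h1 := sphInt_pull σ g
  rw [sphInt_apply, sphInt_apply] at h1
  rw [show (∫ v, F (v : Euc n) (u : Euc n) ∂(sphereMeasure n)) =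
    ∫ v, g v ∂(sphereMeasure n) from rfl, ← h1]
  refine integral_congr_ae (ae_of_all _ fun v => ?_)
  simp only [pull_apply, g, ContinuousMap.coe_mk, ← h, coe_sphMap, hinv]

theorem one_add_inner_nonneg (u v : Sph n) : 0 ≤ 1 + inner ℝ (v : Euc n) (u : Euc n) := by
  have := neg_le_of_abs_le (abs_real_inner_le_norm (v : Euc n) (u : Euc n))
  rw [norm_sph, norm_sph] at this
  linarith

/-- Every convex body is approximated by bodies whose support functions are multiples of smoothed
support functions. -/
theorem exists_dist_lt_smoothing (hn : 2 ≤ n) (K : ConvexBody (Euc n)) {ε : ℝ} (hε : 0 < ε) :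
    ∃ (L : ConvexBody (Euc n)) (k : ℕ) (c : ℝ), dist L K < ε ∧
      sphereSupport L = c • smoothing k (sphereSupport K) := by
  have := nonempty_sph hn
  obtain ⟨u₀⟩ := id this
  obtain ⟨r, hr0, hr⟩ := K.isBounded.exists_pos_norm_le
  let c : ℕ → ℝ := fun k =>
    ∫ v : Sph n, (1 + inner ℝ (v : Euc n) (u₀ : Euc n)) ^ k ∂(sphereMeasure n)
  let d : ℕ → ℝ := fun k => ∫ v : Sph n, (1 + inner ℝ (v : Euc n) (u₀ : Euc n)) ^ k *
    ‖(v : Euc n) - (u₀ : Euc n)‖ ∂(sphereMeasure n)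
  -- The function 1 + ⟨v, u₀⟩ has its unique maximum at u₀, so its normalized powers concentrate
  -- there. Since h_K has Lipschitz constant r, the error is at most r d k / c k.
  have hlim : Tendsto (fun k => (c k)⁻¹ * d k) atTop (𝓝 0) := by
    have h := tendsto_setIntegral_pow_smul_of_unique_maximum_of_isCompact_of_continuousOn
      (μ := sphereMeasure n) (s := univ) isCompact_univ
      (c := fun v : Sph n => 1 + inner ℝ (v : Euc n) (u₀ : Euc n))
      (g := fun v : Sph n => ‖(v : Euc n) - (u₀ : Euc n)‖) (x₀ := u₀)
      (by fun_prop) (by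
        intro y _ hy
        have h1 := inner_lt_one_iff_real_of_norm_eq_one (norm_sph y) (norm_sph u₀)
        have h2 := h1.2 (fun h => hy (Subtype.ext h))
        rw [real_inner_self_eq_norm_sq, norm_sph]
        linarith)
      (fun v _ => one_add_inner_nonneg u₀ v)
      (by rw [real_inner_self_eq_norm_sq, norm_sph]; norm_num) (by simp) (by fun_prop)
    simpa [c, d, setIntegral_univ] using h
  have hcpos : ∀ k, 0 < c k := by
    intro k
    refine Continuous.integral_pos_of_hasCompactSupport_nonneg_nonzero (x := u₀) (by fun_prop)
      (HasCompactSupport.of_compactSpace _) (fun v => pow_nonneg (one_add_inner_nonneg u₀ v) k) ?_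
    rw [real_inner_self_eq_norm_sq, norm_sph]
    norm_num
  have hlim' : Tendsto (fun k => r * ((c k)⁻¹ * d k)) atTop (𝓝 0) := by
    simpa using hlim.const_mul r
  obtain ⟨k, hk⟩ := (hlim'.eventually (gt_mem_nhds (half_pos hε))).exists
  obtain ⟨L, hL⟩ := exists_sphereSupport_eq (f := (c k)⁻¹ • smoothing k (sphereSupport K)) (by
    intro u v w a b t ha hb ht h
    have h1 := smoothing_sphereSupport_mem K hn k u v w a b t ha hb ht h
    have h2 := mul_le_mul_of_nonneg_left h1 (inv_nonneg.2 (hcpos k).le)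
    simp only [ContinuousMap.smul_apply, smul_eq_mul]
    linarith)
  refine ⟨L, k, _, ?_, hL⟩
  rw [← dist_sphereSupport]
  refine lt_of_le_of_lt ((ContinuousMap.dist_le (half_pos hε).le).2 fun u => ?_) (half_lt_self hε)
  have hcu : c k = ∫ v : Sph n, (1 + inner ℝ (v : Euc n) (u : Euc n)) ^ k ∂(sphereMeasure n) :=
    integral_zonal_eq hn (F := fun v u => (1 + inner ℝ v u) ^ k) (by fun_prop)
      (fun e x y => by rw [LinearIsometryEquiv.inner_map_map]) u₀ u
  have hdu : d k = ∫ v : Sph n, (1 + inner ℝ (v : Euc n) (u : Euc n)) ^ k *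
      ‖(v : Euc n) - (u : Euc n)‖ ∂(sphereMeasure n) :=
    integral_zonal_eq hn (F := fun v u => (1 + inner ℝ v u) ^ k * ‖v - u‖) (by fun_prop)
      (fun e x y => by
        rw [LinearIsometryEquiv.inner_map_map, ← map_sub, LinearIsometryEquiv.norm_map]) u₀ u
  have hsub : smoothing k (sphereSupport K) u - c k * sphereSupport K u =
      ∫ v : Sph n, (sphereSupport K v - sphereSupport K u) *
        (1 + inner ℝ (v : Euc n) (u : Euc n)) ^ k ∂(sphereMeasure n) := by
    rw [smoothing_apply, hcu, mul_comm, ← integral_const_mul, ← integral_sub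
      (integrable_of_continuous (by fun_prop)) (integrable_of_continuous (by fun_prop))]
    simp only [sub_mul]
  have hbound : |smoothing k (sphereSupport K) u - c k * sphereSupport K u| ≤ r * d k := by
    rw [hsub, hdu, ← integral_const_mul, ← Real.norm_eq_abs]
    refine norm_integral_le_of_norm_le (integrable_of_continuous (by fun_prop))
      (ae_of_all _ fun v => ?_)
    rw [norm_mul, Real.norm_of_nonneg (pow_nonneg (one_add_inner_nonneg u v) k), Real.norm_eq_abs]
    have h1 := supportFun_sub_le K hr (v : Euc n) (u : Euc n)
    have h2 := supportFun_sub_le K hr (u : Euc n) (v : Euc n)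
    rw [norm_sub_rev] at h2
    have h3 : |sphereSupport K v - sphereSupport K u| ≤ r * ‖(v : Euc n) - (u : Euc n)‖ :=
      abs_le.2 ⟨by simp only [sphereSupport_apply]; linarith,
        by simp only [sphereSupport_apply]; linarith⟩
    calc _ ≤ r * ‖(v : Euc n) - (u : Euc n)‖ * (1 + inner ℝ (v : Euc n) (u : Euc n)) ^ k :=
          mul_le_mul_of_nonneg_right h3 (pow_nonneg (one_add_inner_nonneg u v) k)
      _ = _ := by ring
  rw [hL, Real.dist_eq]
  have e1 : ((c k)⁻¹ • smoothing k (sphereSupport K)) u - sphereSupport K u =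
      (c k)⁻¹ * (smoothing k (sphereSupport K) u - c k * sphereSupport K u) := by
    rw [mul_sub, inv_mul_cancel_left₀ (hcpos k).ne']; rfl
  rw [e1, abs_mul, abs_of_pos (inv_pos.2 (hcpos k))]
  calc (c k)⁻¹ * |smoothing k (sphereSupport K) u - c k * sphereSupport K u|
      ≤ (c k)⁻¹ * (r * d k) := mul_le_mul_of_nonneg_left hbound (inv_nonneg.2 (hcpos k).le)
    _ = r * ((c k)⁻¹ * d k) := by ring
    _ ≤ ε / 2 := hk.le

/-! ### The generated Minkowski class -/

theorem mem_generatedClass (K : ConvexBody (Euc n)) : K ∈ generatedClass K :=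
  fun _ hM => hM.2.2

theorem isMinkowskiClass_generatedClass (K : ConvexBody (Euc n)) :
    IsMinkowskiClass (generatedClass K) where
  isClosed := isClosed_sInter fun _ hM => hM.1.isClosed
  add_mem S hS T hT M hM := hM.1.add_mem S (hS M hM) T (hT M hM)
  smul_mem c hc S hS M hM := hM.1.smul_mem c hc S (hS M hM)

theorem isRotationInvariant_generatedClass (K : ConvexBody (Euc n)) :
    IsRotationInvariant (generatedClass K) :=
  fun g S hS M hM => hM.2.1 g S (hS M hM)

/-- A closed rotation invariant linear condition on support functions passes from a body to the
closure of the generalized bodies of the class that it generates. -/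
theorem sphereSupport_mem_of_mem_closure {V : Submodule ℝ C(Sph n, ℝ)}
    (hV : IsClosed (V : Set C(Sph n, ℝ)))
    (hinv : ∀ (e : Euc n ≃ₗᵢ[ℝ] Euc n), ∀ f ∈ V, pull e f ∈ V) {K : ConvexBody (Euc n)}
    (hK : sphereSupport K ∈ V) {L : ConvexBody (Euc n)}
    (hL : L ∈ closure (generalizedBodies (generatedClass K))) : sphereSupport L ∈ V := by
  have hcl : IsClosed {T : ConvexBody (Euc n) | sphereSupport T ∈ V} :=
    hV.preimage isometry_sphereSupport.continuous
  have hsub : ∀ T ∈ generatedClass K, sphereSupport T ∈ V := by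
    intro T hT
    -- The bodies with support function in V form a rotation invariant Minkowski class containing K,
    -- hence contain the generated one.
    refine hT {T | sphereSupport T ∈ V} ⟨⟨hcl, fun S hS T hT => ?_, fun c hc S hS => ?_⟩,
      fun g S hS => ?_, hK⟩
    · rw [Set.mem_ofPred_eq, sphereSupport_add]
      exact V.add_mem hS hT
    · rw [Set.mem_ofPred_eq, sphereSupport_smul _ hc]
      exact V.smul_mem c hS
    · rw [Set.mem_ofPred_eq, sphereSupport_rotate]
      exact hinv _ _ hS
  refine closure_minimal (t := {T | sphereSupport T ∈ V}) ?_ hcl hL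
  rintro L ⟨S, hS, T, hT, h⟩
  have : sphereSupport L = sphereSupport T - sphereSupport S := by
    rw [← h, sphereSupport_add, add_sub_cancel_right]
  rw [Set.mem_ofPred_eq, this]
  exact V.sub_mem (hsub T hT) (hsub S hS)

/-- The functions whose harmonic component of order `m` vanishes. -/
def harmonicOrthogonal (n m : ℕ) : Submodule ℝ C(Sph n, ℝ) where
  carrier := {f | ∀ q ∈ sphericalHarmonic n m, sphInt n (f * q) = 0}
  add_mem' := fun {f g} hf hg q hq => by rw [add_mul, map_add, hf q hq, hg q hq, add_zero]
  zero_mem' := fun q _ => by rw [zero_mul, map_zero]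
  smul_mem' := fun c f hf q hq => by rw [smul_mul_assoc, map_smul, hf q hq, smul_zero]

theorem mem_harmonicOrthogonal {m : ℕ} {f : C(Sph n, ℝ)} :
    f ∈ harmonicOrthogonal n m ↔ ∀ q ∈ sphericalHarmonic n m, sphInt n (f * q) = 0 := Iff.rfl

theorem harmonicProj_eq_zero_iff_mem {m : ℕ} {f : C(Sph n, ℝ)} :
    harmonicProj n m f = 0 ↔ f ∈ harmonicOrthogonal n m := harmonicProj_eq_zero_iff

theorem isClosed_harmonicOrthogonal (m : ℕ) :
    IsClosed (harmonicOrthogonal n m : Set C(Sph n, ℝ)) := by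
  have : (harmonicOrthogonal n m : Set C(Sph n, ℝ)) =
      ⋂ q ∈ sphericalHarmonic n m, {f | sphInt n (f * q) = 0} := by
    ext f; simp [mem_harmonicOrthogonal]
  rw [this]
  exact isClosed_biInter fun q _ => isClosed_eq
    ((sphInt n).continuous.comp (continuous_id.mul continuous_const)) continuous_const

theorem pull_mem_harmonicOrthogonal (hn : 2 ≤ n) {m : ℕ} (e : Euc n ≃ₗᵢ[ℝ] Euc n)
    {f : C(Sph n, ℝ)} (hf : f ∈ harmonicOrthogonal n m) : pull e f ∈ harmonicOrthogonal n m := by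
  intro q hq
  rw [← pull_pull_symm e q, ← pull_mul, sphInt_pull]
  exact hf _ (pull_mem_sphericalHarmonic hn e.symm hq)

/-! ### Differences of support functions are dense -/

theorem add_mem_sublinearFunctions {f g : C(Sph n, ℝ)} (hf : f ∈ sublinearFunctions n)
    (hg : g ∈ sublinearFunctions n) : f + g ∈ sublinearFunctions n := by
  intro u v w a b c ha hb hc h
  have h1 := hf u v w a b c ha hb hc h
  have h2 := hg u v w a b c ha hb hc h
  simp only [ContinuousMap.add_apply]
  linarith

theorem sup_mem_sublinearFunctions {f g : C(Sph n, ℝ)} (hf : f ∈ sublinearFunctions n)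
    (hg : g ∈ sublinearFunctions n) : f ⊔ g ∈ sublinearFunctions n := by
  intro u v w a b c ha hb hc h
  have h1 := hf u v w a b c ha hb hc h
  have h2 := hg u v w a b c ha hb hc h
  simp only [ContinuousMap.sup_apply]
  rw [mul_max_of_nonneg _ _ hc]
  have h3 := mul_le_mul_of_nonneg_left (le_max_left (f u) (g u)) ha
  have h4 := mul_le_mul_of_nonneg_left (le_max_right (f u) (g u)) ha
  have h5 := mul_le_mul_of_nonneg_left (le_max_left (f v) (g v)) hb
  have h6 := mul_le_mul_of_nonneg_left (le_max_right (f v) (g v)) hb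
  exact max_le (by linarith) (by linarith)

theorem linFun_add_const_mem_sublinearFunctions (y : Euc n) {r : ℝ} (hr : 0 ≤ r) :
    linFun y + ContinuousMap.const _ r ∈ sublinearFunctions n := by
  intro u v w a b c ha hb hc h
  have h1 : c ≤ a + b := by
    have := congrArg norm h
    rw [norm_smul, norm_sph, mul_one, Real.norm_of_nonneg hc] at this
    rw [this]
    refine (norm_add_le _ _).trans ?_
    rw [norm_smul, norm_smul, norm_sph, norm_sph, Real.norm_of_nonneg ha, Real.norm_of_nonneg hb,
      mul_one, mul_one]
  have h2 := congrArg (fun z => inner ℝ y z) h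
  simp only [inner_add_right, real_inner_smul_right] at h2
  have h3 := mul_le_mul_of_nonneg_right h1 hr
  simp only [ContinuousMap.add_apply, linFun_apply, ContinuousMap.const_apply]
  linarith

/-- Lattice form of Stone–Weierstrass: differences of sublinear functions form a lattice, since (a -
b) ⊓ (c - d) = (a + c) - ((b + c) ⊔ (a + d)), and linear functionals plus constants interpolate at
two points. -/
theorem closure_sub_sublinearFunctions :
    closure (sublinearFunctions n - sublinearFunctions n) = ⊤ := by
  have h0 : (0 : C(Sph n, ℝ)) ∈ sublinearFunctions n := by
    intro u v w a b c _ _ _ _; simp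
  refine ContinuousMap.sublattice_closure_eq_top _ ⟨0 - 0, Set.sub_mem_sub h0 h0⟩ ?_ ?_ ?_
  · rintro _ ⟨a, ha, b, hb, rfl⟩ _ ⟨c, hc, d, hd, rfl⟩
    refine ⟨a + c, add_mem_sublinearFunctions ha hc, (b + c) ⊔ (a + d),
      sup_mem_sublinearFunctions (add_mem_sublinearFunctions hb hc)
        (add_mem_sublinearFunctions ha hd), ?_⟩
    ext u
    simp only [ContinuousMap.sub_apply, ContinuousMap.add_apply, ContinuousMap.sup_apply,
      ContinuousMap.inf_apply]
    rcases le_total (a u - b u) (c u - d u) with h | h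
    · rw [min_eq_left h, max_eq_left (by linarith)]; ring
    · rw [min_eq_right h, max_eq_right (by linarith)]; ring
  · rintro _ ⟨a, ha, b, hb, rfl⟩ _ ⟨c, hc, d, hd, rfl⟩
    refine ⟨(a + d) ⊔ (c + b), sup_mem_sublinearFunctions (add_mem_sublinearFunctions ha hd)
        (add_mem_sublinearFunctions hc hb), b + d, add_mem_sublinearFunctions hb hd, ?_⟩
    ext u
    simp only [ContinuousMap.sub_apply, ContinuousMap.add_apply, ContinuousMap.sup_apply]
    rcases le_total (a u - b u) (c u - d u) with h | h
    · rw [max_eq_right h, max_eq_right (by linarith)]; ring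
    · rw [max_eq_left h, max_eq_left (by linarith)]; ring
  · intro v x y
    obtain ⟨z, hz⟩ : ∃ z : Euc n, inner ℝ z (x : Euc n) - inner ℝ z (y : Euc n) = v x - v y := by
      by_cases hxy : x = y
      · exact ⟨0, by simp [hxy]⟩
      have hne : ‖(x : Euc n) - y‖ ^ 2 ≠ 0 :=
        pow_ne_zero 2 (norm_ne_zero_iff.2 (sub_ne_zero.2 (Subtype.coe_ne_coe.2 hxy)))
      refine ⟨((v x - v y) / ‖(x : Euc n) - y‖ ^ 2) • ((x : Euc n) - y), ?_⟩
      rw [← inner_sub_right, real_inner_smul_left, real_inner_self_eq_norm_sq]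
      exact div_mul_cancel₀ _ hne
    set r : ℝ := v x - inner ℝ z (x : Euc n) with hr
    -- A constant is used as a sublinear function only when it is nonnegative, so r is split into
    -- two such parts.
    have hr' : max r 0 - max (-r) 0 = r := by
      rcases le_total 0 r with h | h
      · rw [max_eq_left h, max_eq_right (by linarith)]; ring
      · rw [max_eq_right h, max_eq_left (by linarith)]; ring
    refine ⟨_, Set.sub_mem_sub (linFun_add_const_mem_sublinearFunctions z (le_max_right r 0))
      (linFun_add_const_mem_sublinearFunctions 0 (le_max_right (-r) 0)), ?_, ?_⟩
    · simp only [ContinuousMap.sub_apply, ContinuousMap.add_apply, linFun_apply,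
        ContinuousMap.const_apply, inner_zero_left]
      linarith
    · simp only [ContinuousMap.sub_apply, ContinuousMap.add_apply, linFun_apply,
        ContinuousMap.const_apply, inner_zero_left]
      linarith

/-- Otherwise, by density, every continuous function would be orthogonal to ℋₘ, including a nonzero
element of ℋₘ. -/
theorem exists_sphereSupport_notMem_harmonicOrthogonal (hn : 2 ≤ n) (m : ℕ) :
    ∃ L : ConvexBody (Euc n), sphereSupport L ∉ harmonicOrthogonal n m := by
  have := nonempty_sph hn
  by_contra! hall
  have hsub : (sublinearFunctions n - sublinearFunctions n : Set C(Sph n, ℝ)) ⊆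
      harmonicOrthogonal n m := by
    rintro _ ⟨a, ha, b, hb, rfl⟩
    obtain ⟨S, rfl⟩ := exists_sphereSupport_eq ha
    obtain ⟨T, rfl⟩ := exists_sphereSupport_eq hb
    exact Submodule.sub_mem _ (hall S) (hall T)
  have htop := closure_minimal hsub (isClosed_harmonicOrthogonal m)
  rw [closure_sub_sublinearFunctions] at htop
  obtain ⟨q, hq, hq0⟩ := Submodule.exists_mem_ne_zero_of_ne_bot (sphericalHarmonic_ne_bot hn m)
  exact hq0 (eq_zero_of_sphInt_mul_self (htop (Set.mem_univ q) q hq))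

/-! ### Symmetric bodies -/

/-- Twice the odd part of a function on the sphere. -/
def oddPart (n : ℕ) : C(Sph n, ℝ) →L[ℝ] C(Sph n, ℝ) :=
  ContinuousLinearMap.id ℝ _ - pull (LinearIsometryEquiv.neg ℝ)

theorem oddPart_apply (f : C(Sph n, ℝ)) : oddPart n f = f - pull (LinearIsometryEquiv.neg ℝ) f :=
  rfl

/-- The convex body consisting of a single point. -/
def pointBody (c : Euc n) : ConvexBody (Euc n) :=
  ⟨{c}, convex_singleton c, isCompact_singleton, Set.singleton_nonempty c⟩

theorem sphereSupport_pointBody (c : Euc n) : sphereSupport (pointBody c) = linFun c := by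
  ext u
  have hc : c ∈ pointBody c := Set.mem_singleton c
  rw [sphereSupport_apply, supportFun_eq hc, linFun_apply, real_inner_comm]
  rintro z (rfl : z = c)
  exact le_rfl

theorem sphereSupport_neg (K : ConvexBody (Euc n)) :
    sphereSupport ((-1 : ℝ) • K) = pull (LinearIsometryEquiv.neg ℝ) (sphereSupport K) := by
  ext u; exact supportFun_body_neg K u

theorem linFun_add (x y : Euc n) : linFun (x + y) = linFun x + linFun y := by
  ext u; simp [inner_add_left]

theorem linFun_smul (c : ℝ) (x : Euc n) : linFun (c • x) = c • linFun x := by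
  ext u; simp [real_inner_smul_left]

theorem pull_linFun (e : Euc n ≃ₗᵢ[ℝ] Euc n) (x : Euc n) :
    pull e (linFun x) = linFun (e.symm x) := by
  ext u
  rw [pull_apply, linFun_apply, linFun_apply, coe_sphMap, ← LinearIsometryEquiv.inner_map_map e (e.symm x),
    LinearIsometryEquiv.apply_symm_apply]

/-- `linFun` as a linear map. -/
def linFunLinear (n : ℕ) : Euc n →ₗ[ℝ] C(Sph n, ℝ) where
  toFun := linFun
  map_add' := linFun_add
  map_smul' := linFun_smul

/-- The linear functionals on the sphere. -/
def linFunSpace (n : ℕ) : Submodule ℝ C(Sph n, ℝ) :=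
  LinearMap.range (linFunLinear n)

theorem mem_linFunSpace {f : C(Sph n, ℝ)} : f ∈ linFunSpace n ↔ ∃ x, linFun x = f := Iff.rfl

instance finiteDimensional_linFunSpace : FiniteDimensional ℝ (linFunSpace n) :=
  LinearMap.finiteDimensional_range (linFunLinear n)

/-- Symmetry about c says 2c - K = K, that is, 2⟨c, u⟩ + h_K(-u) = h_K(u). Having a centre thus
becomes a linear condition on h_K. -/
theorem hasCentre_iff (K : ConvexBody (Euc n)) (c : Euc n) :
    HasCentre K c ↔ oddPart n (sphereSupport K) = linFun ((2 : ℝ) • c) := by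
  have h1 : HasCentre K c ↔ pointBody ((2 : ℝ) • c) + (-1 : ℝ) • K = K := by
    rw [HasCentre, ConvexBody.ext_iff]
    have : Equiv.pointReflection c '' (K : Set (Euc n)) =
        ((pointBody ((2 : ℝ) • c) + (-1 : ℝ) • K : ConvexBody (Euc n)) : Set (Euc n)) := by
      rw [ConvexBody.coe_add, ConvexBody.coe_smul]
      ext x
      simp only [pointBody, ConvexBody.coe_mk, Set.singleton_add, Set.mem_image,
        Set.mem_smul_set, Equiv.pointReflection_apply, vsub_eq_sub, vadd_eq_add]
      constructor
      · rintro ⟨y, hy, rfl⟩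
        exact ⟨_, ⟨y, hy, rfl⟩, by module⟩
      · rintro ⟨_, ⟨y, hy, rfl⟩, rfl⟩
        exact ⟨y, hy, by module⟩
    rw [this]
  rw [h1, ← sphereSupport_injective.eq_iff, sphereSupport_add, sphereSupport_pointBody,
    sphereSupport_neg, oddPart_apply, sub_eq_iff_eq_add]
  exact eq_comm

theorem mem_symmetricBodies_iff (K : ConvexBody (Euc n)) :
    K ∈ symmetricBodies n ↔ sphereSupport K ∈ (linFunSpace n).comap (oddPart n).toLinearMap := by
  rw [Submodule.mem_comap, ContinuousLinearMap.coe_coe, mem_linFunSpace]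
  constructor
  · rintro ⟨c, hc⟩
    exact ⟨_, ((hasCentre_iff K c).1 hc).symm⟩
  · rintro ⟨x, hx⟩
    refine ⟨(1 / 2 : ℝ) • x, (hasCentre_iff K _).2 ?_⟩
    rw [← hx, smul_smul]; norm_num

theorem mem_originSymmetricBodies_iff (K : ConvexBody (Euc n)) :
    K ∈ originSymmetricBodies n ↔
      sphereSupport K ∈ (⊥ : Submodule ℝ C(Sph n, ℝ)).comap (oddPart n).toLinearMap := by
  have h0 : linFun ((2 : ℝ) • (0 : Euc n)) = 0 := by ext u; simp
  rw [Submodule.mem_comap, ContinuousLinearMap.coe_coe, Submodule.mem_bot, ← h0]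
  exact hasCentre_iff K 0

theorem oddPart_pull (e : Euc n ≃ₗᵢ[ℝ] Euc n) (f : C(Sph n, ℝ)) :
    oddPart n (pull e f) = pull e (oddPart n f) := by
  ext u
  simp only [oddPart_apply, map_sub, ContinuousMap.sub_apply, pull_apply]
  congr 2
  ext1
  simp

/-- Used for W the linear functionals (arbitrary centre) and W = 0 (centre 0); finite dimension
makes the condition closed. -/
theorem generalizedBodies_subset_of_oddPart {W : Submodule ℝ C(Sph n, ℝ)} [FiniteDimensional ℝ W]
    (hinv : ∀ (e : Euc n ≃ₗᵢ[ℝ] Euc n), ∀ f ∈ W, pull e f ∈ W) {K : ConvexBody (Euc n)}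
    (hK : sphereSupport K ∈ W.comap (oddPart n).toLinearMap) {L : ConvexBody (Euc n)}
    (hL : L ∈ generalizedBodies (generatedClass K)) :
    sphereSupport L ∈ W.comap (oddPart n).toLinearMap := by
  refine sphereSupport_mem_of_mem_closure (V := W.comap (oddPart n).toLinearMap)
    (W.closed_of_finiteDimensional.preimage (oddPart n).continuous) (fun e f hf => ?_) hK
    (subset_closure hL)
  rw [Submodule.mem_comap, ContinuousLinearMap.coe_coe, oddPart_pull]
  exact hinv e _ hf

theorem generalizedBodies_subset_symmetricBodies {K : ConvexBody (Euc n)}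
    (hK : K ∈ symmetricBodies n) :
    generalizedBodies (generatedClass K) ⊆ symmetricBodies n := fun L hL => by
  rw [mem_symmetricBodies_iff] at hK ⊢
  refine generalizedBodies_subset_of_oddPart ?_ hK hL
  rintro e _ ⟨x, rfl⟩
  exact ⟨e.symm x, (pull_linFun e x).symm⟩

theorem generalizedBodies_subset_originSymmetricBodies {K : ConvexBody (Euc n)}
    (hK : K ∈ originSymmetricBodies n) :
    generalizedBodies (generatedClass K) ⊆ originSymmetricBodies n := fun L hL => by
  rw [mem_originSymmetricBodies_iff] at hK ⊢
  refine generalizedBodies_subset_of_oddPart ?_ hK hL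
  intro e f hf
  rw [(Submodule.mem_bot ℝ).1 hf, map_zero]
  exact Submodule.zero_mem _

theorem originSymmetricBodies_subset_symmetricBodies :
    originSymmetricBodies n ⊆ symmetricBodies n := fun _ hK => ⟨0, hK⟩

theorem pull_neg_of_even {m : ℕ} (hm : Even m) {q : C(Sph n, ℝ)}
    (hq : q ∈ sphericalHarmonic n m) : pull (LinearIsometryEquiv.neg ℝ) q = q := by
  obtain ⟨p, hp, rfl⟩ := hq
  ext u
  have h := eval_smul_of_isHomogeneous hp.1 (-1) (fun i => (u : Euc n) i)
  rw [hm.neg_one_pow, one_mul] at h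
  rw [pull_apply, restrictSphere_apply, restrictSphere_apply, ← h]
  congr 2
  ext i
  simp

/-- A centrally symmetric body whose centre is not the origin has a nonzero harmonic component of
order one. -/
theorem harmonicProj_one_ne_zero {K : ConvexBody (Euc n)} {c : Euc n} (hc : HasCentre K c)
    (hc0 : c ≠ 0) : harmonicProj n 1 (sphereSupport K) ≠ 0 := by
  intro h
  rw [harmonicProj_eq_zero_iff] at h
  have hmem : linFun c ∈ sphericalHarmonic n 1 := by
    rw [← polySphere_eq_of_lt_two one_lt_two, ← pow_one (linFun c)]
    exact linFun_pow_mem_polySphere c 1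
  have h1 := h _ hmem
  -- The odd part of h_K would be orthogonal to `linFun c`, although it equals 2 `linFun c`.
  have h2 : sphInt n (pull (LinearIsometryEquiv.neg ℝ) (sphereSupport K) * linFun c) = 0 := by
    have e : linFun c = -pull (LinearIsometryEquiv.neg ℝ) (linFun c) := by ext u; simp
    rw [e, mul_neg, ← pull_mul, map_neg, sphInt_pull, h1, neg_zero]
  have h3 : sphInt n (oddPart n (sphereSupport K) * linFun c) = 0 := by
    rw [oddPart_apply, sub_mul, map_sub, h1, h2, sub_zero]
  rw [(hasCentre_iff K c).1 hc, linFun_smul, smul_mul_assoc, map_smul, smul_eq_mul] at h3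
  have h4 := eq_zero_of_sphInt_mul_self ((mul_eq_zero.1 h3).resolve_left two_ne_zero)
  have h5 := DFunLike.congr_fun h4 ⟨‖c‖⁻¹ • c, by simp [norm_smul, hc0]⟩
  simp [real_inner_smul_right, hc0] at h5

/-! ### Density of generalized bodies -/

theorem isUniversal_of_dense (hn : 2 ≤ n) {K : ConvexBody (Euc n)}
    (h : Dense (generalizedBodies (generatedClass K))) : IsUniversal K := by
  intro m hm
  obtain ⟨L, hL⟩ := exists_sphereSupport_notMem_harmonicOrthogonal hn m
  exact hL (sphereSupport_mem_of_mem_closure (isClosed_harmonicOrthogonal m)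
    (fun e _ hf => pull_mem_harmonicOrthogonal hn e hf) (harmonicProj_eq_zero_iff_mem.1 hm) (h L))

/-- Only approximation of bodies with centre 0 is required, so both cases of (b) are served. The
body L + (-L) doubles the pairing of h_L with even harmonics. -/
theorem isCentrallyUniversal_of_subset_closure (hn : 2 ≤ n) {K : ConvexBody (Euc n)}
    (h : originSymmetricBodies n ⊆ closure (generalizedBodies (generatedClass K))) :
    IsCentrallyUniversal K := by
  intro m hme hm
  obtain ⟨L, hL⟩ := exists_sphereSupport_notMem_harmonicOrthogonal hn m
  refine hL fun q hq => ?_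
  have hpp : ∀ f : C(Sph n, ℝ),
      pull (LinearIsometryEquiv.neg ℝ) (pull (LinearIsometryEquiv.neg ℝ) f) = f :=
    pull_pull_symm (LinearIsometryEquiv.neg ℝ)
  have hS : L + (-1 : ℝ) • L ∈ originSymmetricBodies n := by
    rw [mem_originSymmetricBodies_iff, Submodule.mem_comap, ContinuousLinearMap.coe_coe,
      Submodule.mem_bot, sphereSupport_add, sphereSupport_neg, oddPart_apply, map_add, hpp]
    abel
  have h1 := sphereSupport_mem_of_mem_closure (isClosed_harmonicOrthogonal m)
    (fun e _ hf => pull_mem_harmonicOrthogonal hn e hf) (harmonicProj_eq_zero_iff_mem.1 hm)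
    (h hS) q hq
  have h2 : sphInt n (pull (LinearIsometryEquiv.neg ℝ) (sphereSupport L) * q) =
      sphInt n (sphereSupport L * q) := by
    conv_lhs => rw [← pull_neg_of_even hme hq, ← pull_mul, sphInt_pull]
  rw [sphereSupport_add, sphereSupport_neg, add_mul, map_add, h2] at h1
  linarith

theorem dense_generalizedBodies (hn : 2 ≤ n) {K : ConvexBody (Euc n)} (hK : IsUniversal K) :
    Dense (generalizedBodies (generatedClass K)) := by
  intro L
  have hM := isMinkowskiClass_generatedClass K
  have hne : (generatedClass K).Nonempty := ⟨K, mem_generatedClass K⟩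
  rw [Metric.mem_closure_iff]
  intro ε hε
  obtain ⟨L', k, c, hd, hL'⟩ := exists_dist_lt_smoothing hn L hε
  refine ⟨L', ?_, by rwa [dist_comm]⟩
  rw [mem_generalizedBodies_iff hM hne, hL']
  exact Submodule.smul_mem _ _ (smoothing_mem_of_forall hn (fun m =>
    sphericalHarmonic_le_differenceSpace hn hM hne (isRotationInvariant_generatedClass K)
      (mem_generatedClass K) (hK m)) k _)

/-- Translating L by -d makes its support function even, so smoothing stays in D using even orders
alone; the hypothesis on d allows the translation to be undone. -/
theorem mem_closure_generalizedBodies_of_hasCentre (hn : 2 ≤ n) {K : ConvexBody (Euc n)}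
    (hK : IsCentrallyUniversal K) {L : ConvexBody (Euc n)} {d : Euc n} (hL : HasCentre L d)
    (hd : linFun d ∈ differenceSpace (isMinkowskiClass_generatedClass K)
      ⟨K, mem_generatedClass K⟩) :
    L ∈ closure (generalizedBodies (generatedClass K)) := by
  have hM := isMinkowskiClass_generatedClass K
  have hne : (generatedClass K).Nonempty := ⟨K, mem_generatedClass K⟩
  have hsum : ∀ S : ConvexBody (Euc n), ∀ x, sphereSupport (S + pointBody x) =
      sphereSupport S + linFun x := fun S x => by
    rw [sphereSupport_add, sphereSupport_pointBody]
  have heven : pull (LinearIsometryEquiv.neg ℝ) (sphereSupport (L + pointBody (-d))) =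
      sphereSupport (L + pointBody (-d)) := by
    have h1 := (hasCentre_iff L d).1 hL
    rw [oddPart_apply, sub_eq_iff_eq_add] at h1
    rw [hsum, map_add]
    nth_rewrite 2 [h1]
    ext u
    simp [real_inner_smul_left]
    ring
  rw [Metric.mem_closure_iff]
  intro ε hε
  obtain ⟨L', k, c, hdist, hL'⟩ := exists_dist_lt_smoothing hn (L + pointBody (-d)) hε
  refine ⟨L' + pointBody d, ?_, ?_⟩
  · rw [mem_generalizedBodies_iff hM hne, hsum, hL']
    exact Submodule.add_mem _ (Submodule.smul_mem _ _ (smoothing_mem_of_forall_even hn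
      (fun m hm => sphericalHarmonic_le_differenceSpace hn hM hne
        (isRotationInvariant_generatedClass K) (mem_generatedClass K) (hK m hm)) k heven)) hd
  · rw [← dist_sphereSupport, hsum] at hdist
    rw [dist_comm, ← dist_sphereSupport, hsum]
    rw [dist_eq_norm] at hdist ⊢
    have e : sphereSupport L' + linFun d - sphereSupport L =
        sphereSupport L' - (sphereSupport L + linFun (-d)) := by
      ext u; simp; ring
    rwa [e]

end RotMinkowski

end

theorem theorem2 (n : ℕ) (hn : 2 ≤ n) (K : ConvexBody (EuclideanSpace ℝ (Fin n))) :
    (Dense (RotMinkowski.generalizedBodies (RotMinkowski.generatedClass K)) ↔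
      RotMinkowski.IsUniversal K) ∧
    (∀ c : EuclideanSpace ℝ (Fin n), RotMinkowski.HasCentre K c →
      (c ≠ 0 →
        (RotMinkowski.IsDenseSubset
            (RotMinkowski.generalizedBodies (RotMinkowski.generatedClass K))
            (RotMinkowski.symmetricBodies n) ↔
          RotMinkowski.IsCentrallyUniversal K)) ∧
      (c = 0 →
        (RotMinkowski.IsDenseSubset
            (RotMinkowski.generalizedBodies (RotMinkowski.generatedClass K))
            (RotMinkowski.originSymmetricBodies n) ↔
          RotMinkowski.IsCentrallyUniversal K))) := by
  open RotMinkowski in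
  refine ⟨⟨isUniversal_of_dense hn, dense_generalizedBodies hn⟩, fun c hc => ⟨fun hc0 => ?_, ?_⟩⟩
  · refine ⟨fun h => isCentrallyUniversal_of_subset_closure hn
      (originSymmetricBodies_subset_symmetricBodies.trans h.2), fun hK =>
      ⟨generalizedBodies_subset_symmetricBodies ⟨c, hc⟩, ?_⟩⟩
    rintro L ⟨d, hd⟩
    refine mem_closure_generalizedBodies_of_hasCentre hn hK hd ?_
    -- The nonzero centre of K gives a component of order one, so all linear functionals are
    -- available, whatever the centre d of L.
    refine sphericalHarmonic_le_differenceSpace hn (isMinkowskiClass_generatedClass K) _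
      (isRotationInvariant_generatedClass K) (mem_generatedClass K)
      (harmonicProj_one_ne_zero hc hc0) ?_
    rw [← polySphere_eq_of_lt_two one_lt_two, ← pow_one (linFun d)]
    exact linFun_pow_mem_polySphere d 1
  · rintro rfl
    refine ⟨fun h => isCentrallyUniversal_of_subset_closure hn h.2, fun hK =>
      ⟨generalizedBodies_subset_originSymmetricBodies hc, fun L hL => ?_⟩⟩
    refine mem_closure_generalizedBodies_of_hasCentre hn hK hL ?_
    have h0 : linFun (0 : Euc n) = 0 := by ext u; simp
    rw [h0]
    exact Submodule.zero_mem _
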